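/- **Theorem 2.1 (Comparison of Gaussian to Non-Gaussian Maxima).** Let $n\ge 1$ and $p\ge 3$. Let $x_1,\dots,x_n$ be independent random vectors in $\mathbb{R}^p$, $x_i=(x_{i1},\dots,x_{ip})'$, with $\mathrm{E}[x_i]=0$ and $\mathrm{E}[|x_{ij}|^3]<\infty$ for all $i,j$, and let $y_1,\dots,y_n$ be independent random vectors on the same probability space with $y_i\sim N(0,\mathrm{E}[x_ix_i'])$. (No relation between the joint law of $(x_i)_{i=1}^n$ and $(y_i)_{i=1}^n$ is required; they may in particular be independent of each other.) Write $\bar{\mathrm{E}}[f_i]=n^{-1}\sum_{i=1}^n\mathrm{E}[f_i]$ and $a\vee b=\max\{a,b\}$, and put $$X=\frac1{\sqrt n}\sum_{i=1}^n x_i,\quad Y=\frac1{\sqrt n}\sum_{i=1}^n y_i,\quad T_0=\max_{1\le j\le p}X_j,\quad Z_0=\max_{1\le j\le p}Y_j,$$ $$M_k=\max_{1\le j\le p}\big(\bar{\mathrm{E}}[|x_{ij}|^k]\big)^{1/k},\qquad F_\beta(z)=\beta^{-1}\log\Big(\sum_{j=1}^p e^{\beta z_j}\Big),\quad z\in\mathbb{R}^p.$$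 For $u>0$ let $\varphi_x(u)$ be the infimum of all $\varphi\ge0$ such that, for every $1\le j\le p$, $$\bar{\mathrm{E}}\big[x_{ij}^2\,1\{|x_{ij}|>u(\bar{\mathrm{E}}[x_{ij}^2])^{1/2}\}\big]\le\varphi^2\,\bar{\mathrm{E}}[x_{ij}^2],$$ and for $\gamma\in(0,1)$ let $u_x(\gamma)$ be the infimum of all $u\ge0$ such that $$\Pr\big(|x_{ij}|\le u(\bar{\mathrm{E}}[x_{ij}^2])^{1/2},\ 1\le i\le n,\ 1\le j\le p\big)\ge1-\gamma.$$ Define $\varphi_y(u)$ and $u_y(\gamma)$ in the same way with $(y_i)$ in place of $(x_i)$, and set $\varphi(u)=\varphi_x(u)\vee\varphi_y(u)$ and $u(\gamma)=u_x(\gamma)\vee u_y(\gamma)$. Let $C_b^3(\mathbb{R})$ be the class of three times continuously differentiable $g:\mathbb{R}\to\mathbb{R}$ with $G_k:=\sup_{z\in\mathbb{R}}|\partial^kg(z)|<\infty$ for $k=0,1,2,3$. There is a universal constant $C>0$ (independent of $n$, $p$, the laws of the $x_i$, $\beta$, $u$, $\gamma$ and $g$) such that, whenever $\beta>0$, $u>0$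 and $\gamma\in(0,1)$ satisfy $$\frac{2\sqrt2\,u\,M_2\,\beta}{\sqrt n}\le1\qquad\text{and}\qquad u\ge u(\gamma),$$ one has for every $g\in C_b^3(\mathbb{R})$ $$\big|\mathrm{E}[g(F_\beta(X))-g(F_\beta(Y))]\big|\le C\,D_n(g,\beta,u,\gamma)$$ and $$\big|\mathrm{E}[g(T_0)-g(Z_0)]\big|\le C\big(D_n(g,\beta,u,\gamma)+\beta^{-1}G_1\log p\big),$$ where $$D_n(g,\beta,u,\gamma)=n^{-1/2}(G_3+G_2\beta+G_1\beta^2)M_3^3+(G_2+\beta G_1)M_2^2\varphi(u)+G_1M_2\varphi(u)\sqrt{\log(p/\gamma)}+G_0\gamma.$$ -/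

import Mathlib

open MeasureTheory ProbabilityTheory

namespace GaussMax

noncomputable section

variable {Ω : Type*} [MeasurableSpace Ω] {n p : ℕ}

/-- The average over `i` of the expectations `E[f i]`, written `Ē[f_i]`. -/
def avgE (P : Measure Ω) (f : Fin n → Ω → ℝ) : ℝ :=
  (n : ℝ)⁻¹ * ∑ i, ∫ ω, f i ω ∂P

/-- The rescaled sum `n^{-1/2} ∑ᵢ xᵢ`, a random vector in `ℝᵖ`. -/
def rescaledSum (x : Fin n → Ω → Fin p → ℝ) (ω : Ω) (j : Fin p) : ℝ :=
  (√(n : ℝ))⁻¹ * ∑ i, x i ω j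

/-- The maximum coordinate of a vector (a genuine maximum when `0 < p`). -/
def maxCoord (z : Fin p → ℝ) : ℝ := ⨆ j, z j

/-- The smooth max function `F_β(z) = β⁻¹ log ∑ⱼ exp(β zⱼ)`. -/
def smoothMax (β : ℝ) (z : Fin p → ℝ) : ℝ :=
  β⁻¹ * Real.log (∑ j, Real.exp (β * z j))

/-- `(Ē[x_{ij}²])^{1/2}`. -/
def sigma (P : Measure Ω) (x : Fin n → Ω → Fin p → ℝ) (j : Fin p) : ℝ :=
  √(avgE P fun i ω => (x i ω j) ^ 2)

/-- `M_k = max_j (Ē[|x_{ij}|^k])^{1/k}`. -/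
def momentBound (P : Measure Ω) (x : Fin n → Ω → Fin p → ℝ) (k : ℕ) : ℝ :=
  ⨆ j, (avgE P fun i ω => |x i ω j| ^ k) ^ (1 / (k : ℝ))

/-- The truncation impact: the least `φ ≥ 0` such that, for all `j`,
`Ē[x_{ij}² 1{|x_{ij}| > u (Ē[x_{ij}²])^{1/2}}] ≤ φ² Ē[x_{ij}²]`. -/
def truncImpact (P : Measure Ω) (x : Fin n → Ω → Fin p → ℝ) (u : ℝ) : ℝ :=
  sInf {φ : ℝ | 0 ≤ φ ∧ ∀ j,
    avgE P (fun i => {ω | u * sigma P x j < |x i ω j|}.indicator fun ω => (x i ω j) ^ 2)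
      ≤ φ ^ 2 * avgE P fun i ω => (x i ω j) ^ 2}

/-- The least `u ≥ 0` such that
`P(|x_{ij}| ≤ u (Ē[x_{ij}²])^{1/2} for all i, j) ≥ 1 - γ`. -/
def upperQuantile (P : Measure Ω) (x : Fin n → Ω → Fin p → ℝ) (γ : ℝ) : ℝ :=
  sInf {u : ℝ | 0 ≤ u ∧ 1 - γ ≤ P.real {ω | ∀ i j, |x i ω j| ≤ u * sigma P x j}}

/-- `φ(u) = φ_x(u) ∨ φ_y(u)`. -/
def phi (P : Measure Ω) (x y : Fin n → Ω → Fin p → ℝ) (u : ℝ) : ℝ :=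
  max (truncImpact P x u) (truncImpact P y u)

/-- `u(γ) = u_x(γ) ∨ u_y(γ)`. -/
def uGamma (P : Measure Ω) (x y : Fin n → Ω → Fin p → ℝ) (γ : ℝ) : ℝ :=
  max (upperQuantile P x γ) (upperQuantile P y γ)

/-- The class `C_b³(ℝ)`. -/
def IsCb3 (g : ℝ → ℝ) : Prop :=
  ContDiff ℝ 3 g ∧ ∀ k ≤ 3, ∃ B : ℝ, ∀ z, |iteratedDeriv k g z| ≤ B

/-- `G_k = sup_z |∂ᵏ g(z)|`. -/
def supDeriv (g : ℝ → ℝ) (k : ℕ) : ℝ := ⨆ z : ℝ, |iteratedDeriv k g z|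

/-- The error bound `D_n(g, β, u, γ)`. -/
def errorBound (P : Measure Ω) (x y : Fin n → Ω → Fin p → ℝ) (g : ℝ → ℝ) (β u γ : ℝ) : ℝ :=
  (√(n : ℝ))⁻¹ * (supDeriv g 3 + supDeriv g 2 * β + supDeriv g 1 * β ^ 2) * momentBound P x 3 ^ 3
    + (supDeriv g 2 + β * supDeriv g 1) * momentBound P x 2 ^ 2 * phi P x y u
    + supDeriv g 1 * momentBound P x 2 * phi P x y u * √(Real.log (p / γ))
    + supDeriv g 0 * γ

end

end GaussMax

/-!
The law of `x` and the law of `y` enter the two sides separately, so the two families may be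
realized independently of each other (`abs_integral_smoothMax_sub_le_of_iIndepFun`). For bounded
summands, the sums are joined by the path `sin θ • X + cos θ • Y`. Its derivative is a sum over the
pairs `(xᵢ, yᵢ)`; in the `i`-th term the differential of `g ∘ smoothMax β` is expanded to first
order around the sum of the other pairs, which is independent of `(xᵢ, yᵢ)`. The zeroth-order term
has mean zero, the first-order term only sees the difference of the covariances, and the remainder
is cubic (`abs_integral_step_le`).

The dimension does not appear because the derivatives of `smoothMax β` are expressed by the softmax
weights, which sum to one, and all third-order terms are dominated by the softmax average of the
cubes of the increments (`exists_hasDerivAt_hessForm`). Since an increment is at most of order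
`1 / β`, it changes the weights by a constant factor only (`softAvg_le_exp_mul`). The weights at the sum
of the others, needed for independence, are therefore comparable to the weights at the full sum,
which do not depend on `i`; so the summation over `i` acts on the moments alone and produces maxima
over coordinates of averaged moments.

Unbounded summands are truncated at `u * sigma P x j` and centered. On the event that no threshold
is exceeded, of probability at least `1 - γ`, truncation displaces the sum by a deterministic
vector. If `γ ≤ 1 / 2`, independence bounds the expected number of exceedances in a coordinate by
one (`sum_prob_exceed_le_one`), and the Cauchy–Schwarz inequality bounds the displacement by
`momentBound P x 2 * φ(u)`. The same truncation changes the covariances by at most a multiple of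
`momentBound P x 2 ^ 2 * φ(u)`. Gaussianity of `y` is used only to bound its third moments by those
of `x`. If `γ > 1 / 2`, the term `G₀ γ` suffices. Finally `smoothMax β` exceeds the maximum by at
most `β⁻¹ log p`.
-/

namespace GaussMax

/-! ### Softmax averages and the derivatives of the smooth maximum -/

/-- The partition function `∑ⱼ exp(β zⱼ)`. -/
noncomputable def expSum {p : ℕ} (β : ℝ) (z : Fin p → ℝ) : ℝ := ∑ j, Real.exp (β * z j)

/-- The mean of `f` under the softmax weights `exp(β zⱼ) / ∑ₖ exp(β zₖ)`, which are the partial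
derivatives of `smoothMax β` at `z`. -/
noncomputable def softAvg {p : ℕ} (β : ℝ) (z f : Fin p → ℝ) : ℝ :=
  (∑ j, Real.exp (β * z j) * f j) / expSum β z

section softmax

variable {p : ℕ}

lemma expSum_pos [NeZero p] (β : ℝ) (z : Fin p → ℝ) : 0 < expSum β z :=
  Finset.sum_pos (fun _ _ => Real.exp_pos _) Finset.univ_nonempty

lemma softAvg_add (β : ℝ) (z f h : Fin p → ℝ) :
    softAvg β z (fun j => f j + h j) = softAvg β z f + softAvg β z h := by
  simp only [softAvg, mul_add, Finset.sum_add_distrib, add_div]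

lemma softAvg_const_mul (β : ℝ) (z f : Fin p → ℝ) (c : ℝ) :
    softAvg β z (fun j => c * f j) = c * softAvg β z f := by
  simp only [softAvg, mul_left_comm _ c, ← Finset.mul_sum, mul_div_assoc]

lemma softAvg_sum {ι : Type*} (s : Finset ι) (β : ℝ) (z : Fin p → ℝ) (f : ι → Fin p → ℝ) :
    softAvg β z (fun j => ∑ i ∈ s, f i j) = ∑ i ∈ s, softAvg β z (f i) := by
  simp only [softAvg, Finset.mul_sum]
  rw [Finset.sum_comm, Finset.sum_div]

lemma softAvg_const [NeZero p] (β : ℝ) (z : Fin p → ℝ) (c : ℝ) :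
    softAvg β z (fun _ => c) = c := by
  have h := (expSum_pos β z).ne'
  simp only [softAvg, ← Finset.sum_mul]
  rw [← expSum]
  field_simp

lemma softAvg_mono [NeZero p] (β : ℝ) (z : Fin p → ℝ) {f h : Fin p → ℝ} (hfh : ∀ j, f j ≤ h j) :
    softAvg β z f ≤ softAvg β z h := by
  have := expSum_pos β z
  unfold softAvg
  gcongr with j
  exact hfh j

lemma softAvg_nonneg [NeZero p] (β : ℝ) (z : Fin p → ℝ) {f : Fin p → ℝ} (hf : ∀ j, 0 ≤ f j) :
    0 ≤ softAvg β z f := by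
  simpa [softAvg_const] using softAvg_mono β z hf

lemma softAvg_le_of_le [NeZero p] (β : ℝ) (z : Fin p → ℝ) {f : Fin p → ℝ} {c : ℝ}
    (hf : ∀ j, f j ≤ c) : softAvg β z f ≤ c := by
  simpa [softAvg_const] using softAvg_mono β z hf

lemma abs_softAvg_le [NeZero p] (β : ℝ) (z : Fin p → ℝ) {f h : Fin p → ℝ}
    (hfh : ∀ j, |f j| ≤ h j) : |softAvg β z f| ≤ softAvg β z h := by
  have h0 := softAvg_mono β z fun j => (le_abs_self (f j)).trans (hfh j)
  have h1 := softAvg_mono β z fun j => (neg_le_abs (f j)).trans (hfh j)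
  have h2 := softAvg_const_mul β z f (-1)
  simp only [neg_one_mul] at h2
  rw [h2] at h1
  exact abs_le.2 ⟨by linarith, h0⟩

/-- Softmax weights at two points whose coordinates are within `a / β` of each other are
comparable, which is what lets a bounded summand be removed from, or returned to, a sum. -/
lemma softAvg_le_exp_mul [NeZero p] {β a : ℝ} {z z' f : Fin p → ℝ} (hf : ∀ j, 0 ≤ f j)
    (h : ∀ j, |β * z j - β * z' j| ≤ a) :
    softAvg β z f ≤ Real.exp (2 * a) * softAvg β z' f := by
  have hS := expSum_pos β z
  have hS' := expSum_pos β z'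
  have h1 : ∑ j, Real.exp (β * z j) * f j ≤ Real.exp a * ∑ j, Real.exp (β * z' j) * f j := by
    rw [Finset.mul_sum]
    refine Finset.sum_le_sum fun j _ => ?_
    rw [← mul_assoc, ← Real.exp_add]
    refine mul_le_mul_of_nonneg_right (Real.exp_le_exp.2 ?_) (hf j)
    linarith [(abs_le.1 (h j)).2]
  have h2 : expSum β z' ≤ Real.exp a * expSum β z := by
    unfold expSum
    rw [Finset.mul_sum]
    refine Finset.sum_le_sum fun j _ => ?_
    rw [← Real.exp_add]
    exact Real.exp_le_exp.2 (by linarith [(abs_le.1 (h j)).1])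
  have h0 : 0 ≤ ∑ j, Real.exp (β * z' j) * f j :=
    Finset.sum_nonneg fun j _ => mul_nonneg (Real.exp_pos _).le (hf j)
  unfold softAvg
  rw [div_le_iff₀ hS]
  calc _ ≤ Real.exp a * ∑ j, Real.exp (β * z' j) * f j := h1
    _ = Real.exp a * ((∑ j, Real.exp (β * z' j) * f j) / expSum β z' * expSum β z') := by
        rw [div_mul_cancel₀ _ hS'.ne']
    _ ≤ Real.exp a * ((∑ j, Real.exp (β * z' j) * f j) / expSum β z'
          * (Real.exp a * expSum β z)) := by gcongr
    _ = _ := by rw [two_mul, Real.exp_add]; ring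

/-- Jensen's inequality for the cube. -/
lemma abs_softAvg_pow_three_le [NeZero p] (β : ℝ) (z f : Fin p → ℝ) :
    |softAvg β z f| ^ 3 ≤ softAvg β z (fun j => |f j| ^ 3) := by
  set a := softAvg β z (fun j => |f j|) with ha
  have ha0 : 0 ≤ a := softAvg_nonneg β z fun j => abs_nonneg _
  have h1 : |softAvg β z f| ≤ a := abs_softAvg_le β z fun j => le_rfl
  have h2 : softAvg β z (fun j => 3 * a ^ 2 * |f j| + (-2 * a ^ 3))
      ≤ softAvg β z (fun j => |f j| ^ 3) := by
    refine softAvg_mono β z fun j => ?_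
    -- the tangent line of the cube at `a`
    have ht := abs_nonneg (f j)
    nlinarith [mul_nonneg (add_nonneg ht (add_nonneg ha0 ha0)) (sq_nonneg (|f j| - a))]
  rw [softAvg_add, softAvg_const_mul, softAvg_const, ← ha] at h2
  calc |softAvg β z f| ^ 3 ≤ a ^ 3 := by gcongr
    _ = 3 * a ^ 2 * a + (-2 * a ^ 3) := by ring
    _ ≤ _ := h2

lemma hasDerivAt_expSum (β : ℝ) {c : ℝ → Fin p → ℝ} {c' f : Fin p → ℝ} {t : ℝ}
    (hc : ∀ j, HasDerivAt (fun s => c s j) (c' j) t) :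
    HasDerivAt (fun s => ∑ j, Real.exp (β * c s j) * f j)
      (β * ∑ j, Real.exp (β * c t j) * (f j * c' j)) t := by
  have : HasDerivAt (fun s => ∑ j, Real.exp (β * c s j) * f j)
      (∑ j, Real.exp (β * c t j) * (β * c' j) * f j) t :=
    HasDerivAt.fun_sum fun j _ => (((hc j).const_mul β).exp).mul_const (f j)
  convert this using 1
  rw [Finset.mul_sum]
  exact Finset.sum_congr rfl fun j _ => by ring

lemma hasDerivAt_smoothMax [NeZero p] {β : ℝ} (hβ : β ≠ 0) {c : ℝ → Fin p → ℝ} {c' : Fin p → ℝ}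
    {t : ℝ} (hc : ∀ j, HasDerivAt (fun s => c s j) (c' j) t) :
    HasDerivAt (fun s => smoothMax β (c s)) (softAvg β (c t) c') t := by
  have h1 := hasDerivAt_expSum β (f := fun _ => 1) hc
  simp only [mul_one, one_mul] at h1
  have h2 := (h1.log (expSum_pos β (c t)).ne').const_mul β⁻¹
  refine h2.congr_deriv ?_
  unfold softAvg expSum
  field_simp

lemma hasDerivAt_softAvg [NeZero p] (β : ℝ) {c : ℝ → Fin p → ℝ} {c' : Fin p → ℝ} {t : ℝ}
    (hc : ∀ j, HasDerivAt (fun s => c s j) (c' j) t) (f : Fin p → ℝ) :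
    HasDerivAt (fun s => softAvg β (c s) f)
      (β * (softAvg β (c t) (fun j => f j * c' j) - softAvg β (c t) f * softAvg β (c t) c')) t := by
  have h1 := hasDerivAt_expSum β (f := fun _ => 1) hc
  simp only [mul_one, one_mul] at h1
  have hS := (expSum_pos β (c t)).ne'
  have h2 := (hasDerivAt_expSum β (f := f) hc).div h1 hS
  have hS' : ∑ j, Real.exp (β * c t j) ≠ 0 := hS
  refine h2.congr_deriv ?_
  unfold softAvg expSum
  field_simp

lemma abs_mul_mul_le_cubes {a b c : ℝ} : |a * b * c| ≤ |a| ^ 3 + |b| ^ 3 + |c| ^ 3 := by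
  rw [abs_mul, abs_mul]
  have h : ∀ x y z : ℝ, 0 ≤ x → 0 ≤ y → 0 ≤ z → x * y * z ≤ x ^ 3 + y ^ 3 + z ^ 3 := by
    intro x y z hx hy hz
    have h0 : 0 ≤ x * y * z := by positivity
    nlinarith [mul_nonneg (add_nonneg (add_nonneg hx hy) hz)
      (add_nonneg (add_nonneg (sq_nonneg (x - y)) (sq_nonneg (y - z))) (sq_nonneg (z - x)))]
  exact h _ _ _ (abs_nonneg _) (abs_nonneg _) (abs_nonneg _)

lemma abs_mul_mul_le_cubes' {a b : ℝ} : |a * b * b| ≤ |a| ^ 3 + |b| ^ 3 := by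
  rw [abs_mul, abs_mul]
  have h : ∀ x y : ℝ, 0 ≤ x → 0 ≤ y → x * y * y ≤ x ^ 3 + y ^ 3 := by
    intro x y hx hy
    have h3 : 0 ≤ x ^ 3 := by positivity
    nlinarith [mul_nonneg (add_nonneg hx hy) (sq_nonneg (x - y)),
      mul_nonneg hx (sq_nonneg (x - y)), mul_nonneg hy (sq_nonneg (x - y))]
  exact h _ _ (abs_nonneg _) (abs_nonneg _)

lemma abs_softAvg_triple_le [NeZero p] (β : ℝ) (z v w : Fin p → ℝ) :
    |softAvg β z v * softAvg β z v * softAvg β z w|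
      ≤ softAvg β z (fun j => |v j| ^ 3 + |w j| ^ 3) := by
  have h1 := abs_softAvg_pow_three_le β z v
  have h2 := abs_softAvg_pow_three_le β z w
  have h3 := abs_mul_mul_le_cubes' (a := softAvg β z w) (b := softAvg β z v)
  rw [softAvg_add, show softAvg β z v * softAvg β z v * softAvg β z w
    = softAvg β z w * softAvg β z v * softAvg β z v by ring]
  linarith

lemma abs_softAvg_sq_mul_le [NeZero p] (β : ℝ) (z v w : Fin p → ℝ) :
    |softAvg β z (fun j => v j * v j) * softAvg β z w|
      ≤ softAvg β z (fun j => |v j| ^ 3 + |w j| ^ 3) := by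
  have h2 := abs_softAvg_pow_three_le β z w
  rw [mul_comm, ← softAvg_const_mul]
  have h3 : |softAvg β z (fun j => softAvg β z w * (v j * v j))|
      ≤ softAvg β z (fun j => |v j| ^ 3 + |softAvg β z w| ^ 3) := by
    refine abs_softAvg_le β z fun j => ?_
    have := abs_mul_mul_le_cubes' (a := softAvg β z w) (b := v j)
    rw [← mul_assoc]; linarith
  rw [softAvg_add, softAvg_const] at h3
  rw [softAvg_add]
  linarith

lemma abs_softAvg_mul_prod_le [NeZero p] (β : ℝ) (z v w : Fin p → ℝ) :
    |softAvg β z v * softAvg β z (fun j => w j * v j)|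
      ≤ 2 * softAvg β z (fun j => |v j| ^ 3 + |w j| ^ 3) := by
  have h2 := abs_softAvg_pow_three_le β z v
  have h0 : 0 ≤ softAvg β z (fun j => |w j| ^ 3) := softAvg_nonneg β z fun j => by positivity
  rw [← softAvg_const_mul]
  have h3 : |softAvg β z (fun j => softAvg β z v * (w j * v j))|
      ≤ softAvg β z (fun j => (|v j| ^ 3 + |w j| ^ 3) + |softAvg β z v| ^ 3) := by
    refine abs_softAvg_le β z fun j => ?_
    have := abs_mul_mul_le_cubes (a := softAvg β z v) (b := w j) (c := v j)
    rw [← mul_assoc]; linarith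
  rw [softAvg_add, softAvg_const, softAvg_add] at h3
  rw [softAvg_add]
  linarith

lemma abs_softAvg_cubic_le [NeZero p] (β : ℝ) (z v w : Fin p → ℝ) :
    |softAvg β z (fun j => w j * v j * v j)|
      ≤ softAvg β z (fun j => |v j| ^ 3 + |w j| ^ 3) := by
  refine abs_softAvg_le β z fun j => ?_
  have := abs_mul_mul_le_cubes' (a := w j) (b := v j)
  linarith

/-- The second differential of `g ∘ smoothMax β` at `z`, evaluated at `(v, w)`; `d₁` and `d₂` stand
for `g'` and `g''` at `smoothMax β z`. -/
noncomputable def hessForm (β d₁ d₂ : ℝ) (z v w : Fin p → ℝ) : ℝ :=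
  d₂ * softAvg β z v * softAvg β z w
    + d₁ * (β * (softAvg β z (fun j => w j * v j) - softAvg β z w * softAvg β z v))

lemma hasDerivAt_grad_smoothMax [NeZero p] {β : ℝ} (hβ : β ≠ 0) {g₁ g₂ : ℝ → ℝ}
    (h₁ : ∀ t, HasDerivAt g₁ (g₂ t) t) {c : ℝ → Fin p → ℝ} {v : Fin p → ℝ} (w : Fin p → ℝ)
    {t : ℝ} (hc : ∀ j, HasDerivAt (fun s => c s j) (v j) t) :
    HasDerivAt (fun s => g₁ (smoothMax β (c s)) * softAvg β (c s) w)
      (hessForm β (g₁ (smoothMax β (c t))) (g₂ (smoothMax β (c t))) (c t) v w) t := by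
  have hF := hasDerivAt_smoothMax hβ hc
  exact ((h₁ (smoothMax β (c t))).comp t hF).mul (hasDerivAt_softAvg β hc w)

/-- The third differential of `g ∘ smoothMax β` is dominated by softmax averages of cubes. -/
lemma exists_hasDerivAt_hessForm [NeZero p] {β : ℝ} (hβ : 0 < β) {g₁ g₂ g₃ : ℝ → ℝ}
    {G₁ G₂ G₃ : ℝ}
    (h₁ : ∀ t, HasDerivAt g₁ (g₂ t) t) (h₂ : ∀ t, HasDerivAt g₂ (g₃ t) t)
    (b₁ : ∀ t, |g₁ t| ≤ G₁) (b₂ : ∀ t, |g₂ t| ≤ G₂) (b₃ : ∀ t, |g₃ t| ≤ G₃)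
    {c : ℝ → Fin p → ℝ} {v : Fin p → ℝ} (w : Fin p → ℝ)
    {t : ℝ} (hc : ∀ j, HasDerivAt (fun s => c s j) (v j) t) :
    ∃ d, HasDerivAt (fun s => hessForm β (g₁ (smoothMax β (c s))) (g₂ (smoothMax β (c s)))
        (c s) v w) d t ∧
      |d| ≤ 8 * (G₃ + G₂ * β + G₁ * β ^ 2) * softAvg β (c t) (fun j => |v j| ^ 3 + |w j| ^ 3) := by
  have hF := hasDerivAt_smoothMax hβ.ne' hc
  have d₁ := (h₁ (smoothMax β (c t))).comp t hF
  have d₂ := (h₂ (smoothMax β (c t))).comp t hF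
  have dv := hasDerivAt_softAvg β hc v
  have dw := hasDerivAt_softAvg β hc w
  have dwv := hasDerivAt_softAvg β hc (fun j => w j * v j)
  refine ⟨_, ((d₂.mul dv).mul dw).add (d₁.mul ((dwv.sub (dw.mul dv)).const_mul β)), ?_⟩
  have t₁ := abs_softAvg_triple_le β (c t) v w
  have t₂ := abs_softAvg_sq_mul_le β (c t) v w
  have t₃ := abs_softAvg_mul_prod_le β (c t) v w
  have t₄ := abs_softAvg_cubic_le β (c t) v w
  have hT : 0 ≤ softAvg β (c t) (fun j => |v j| ^ 3 + |w j| ^ 3) :=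
    softAvg_nonneg β _ fun j => by positivity
  simp only [Function.comp_apply, Pi.mul_apply]
  generalize softAvg β (c t) (fun j => |v j| ^ 3 + |w j| ^ 3) = T at *
  generalize softAvg β (c t) v = A at *
  generalize softAvg β (c t) w = B at *
  generalize softAvg β (c t) (fun j => v j * v j) = Q at *
  generalize softAvg β (c t) (fun j => w j * v j) = R at *
  generalize softAvg β (c t) (fun j => w j * v j * v j) = K at *
  have e₁ := b₁ (smoothMax β (c t))
  have e₂ := b₂ (smoothMax β (c t))
  have e₃ := b₃ (smoothMax β (c t))
  generalize g₁ (smoothMax β (c t)) = u₁ at *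
  generalize g₂ (smoothMax β (c t)) = u₂ at *
  generalize g₃ (smoothMax β (c t)) = u₃ at *
  have k₂ : |Q * B + 2 * (A * R) - 3 * (A * A * B)| ≤ 8 * T := by
    rw [abs_le] at *
    constructor <;> linarith [t₁.1, t₁.2, t₂.1, t₂.2, t₃.1, t₃.2]
  have k₁ : |K - 2 * (A * R) + 2 * (A * A * B) - Q * B| ≤ 8 * T := by
    rw [abs_le] at *
    constructor <;> linarith [t₁.1, t₁.2, t₂.1, t₂.2, t₃.1, t₃.2, t₄.1, t₄.2]
  have n₂ : 0 ≤ G₂ := (abs_nonneg _).trans e₂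
  have n₁ : 0 ≤ G₁ := (abs_nonneg _).trans e₁
  have n₃ : 0 ≤ G₃ := (abs_nonneg _).trans e₃
  have m₃ : |u₃ * (A * A * B)| ≤ G₃ * (8 * T) := by
    rw [abs_mul]
    exact mul_le_mul e₃ (by linarith) (abs_nonneg _) n₃
  have m₂ : |u₂ * (Q * B + 2 * (A * R) - 3 * (A * A * B))| ≤ G₂ * (8 * T) := by
    rw [abs_mul]
    exact mul_le_mul e₂ k₂ (abs_nonneg _) n₂
  have m₁ : |u₁ * (K - 2 * (A * R) + 2 * (A * A * B) - Q * B)| ≤ G₁ * (8 * T) := by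
    rw [abs_mul]
    exact mul_le_mul e₁ k₁ (abs_nonneg _) n₁
  have m₂' := mul_le_mul_of_nonneg_left m₂ hβ.le
  have m₁' := mul_le_mul_of_nonneg_left m₁ (sq_nonneg β)
  rw [show ∀ x : ℝ, β * |x| = |β * x| from fun x => by rw [abs_mul, abs_of_pos hβ]] at m₂'
  rw [show ∀ x : ℝ, β ^ 2 * |x| = |β ^ 2 * x| from fun x => by
    rw [abs_mul, abs_of_pos (by positivity : 0 < β ^ 2)]] at m₁'
  rw [abs_le] at *
  constructor <;> linarith [m₃.1, m₃.2, m₂'.1, m₂'.2, m₁'.1, m₁'.2]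

/-- First-order Taylor expansion of the differential of `g ∘ smoothMax β` along a step `v` whose
coordinates are at most `2 / β`, with the remainder controlled at the starting point. -/
lemma abs_grad_taylor_le [NeZero p] {β : ℝ} (hβ : 0 < β) {g₁ g₂ g₃ : ℝ → ℝ} {G₁ G₂ G₃ : ℝ}
    (h₁ : ∀ t, HasDerivAt g₁ (g₂ t) t) (h₂ : ∀ t, HasDerivAt g₂ (g₃ t) t)
    (b₁ : ∀ t, |g₁ t| ≤ G₁) (b₂ : ∀ t, |g₂ t| ≤ G₂) (b₃ : ∀ t, |g₃ t| ≤ G₃)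
    (z v w : Fin p → ℝ) (hv : ∀ j, |β * v j| ≤ 2) :
    |g₁ (smoothMax β (z + v)) * softAvg β (z + v) w
        - g₁ (smoothMax β z) * softAvg β z w
        - hessForm β (g₁ (smoothMax β z)) (g₂ (smoothMax β z)) z v w|
      ≤ 8 * Real.exp 4 * (G₃ + G₂ * β + G₁ * β ^ 2)
        * softAvg β z (fun j => |v j| ^ 3 + |w j| ^ 3) := by
  set T := softAvg β z (fun j => |v j| ^ 3 + |w j| ^ 3)
  set K := 8 * Real.exp 4 * (G₃ + G₂ * β + G₁ * β ^ 2) * T with hK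
  have n₁ : 0 ≤ G₁ := (abs_nonneg _).trans (b₁ 0)
  have n₂ : 0 ≤ G₂ := (abs_nonneg _).trans (b₂ 0)
  have n₃ : 0 ≤ G₃ := (abs_nonneg _).trans (b₃ 0)
  let c : ℝ → Fin p → ℝ := fun s j => z j + s * v j
  have hc : ∀ s j, HasDerivAt (fun s => c s j) (v j) s := fun s j => by
    simpa [c] using ((hasDerivAt_id s).mul_const (v j)).const_add (z j)
  let H : ℝ → ℝ := fun s => hessForm β (g₁ (smoothMax β (c s))) (g₂ (smoothMax β (c s))) (c s) v w
  have c0 : c 0 = z := by ext j; simp [c]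
  have c1 : c 1 = z + v := by ext j; simp [c]
  have hT : ∀ s ∈ Set.Icc (0 : ℝ) 1,
      softAvg β (c s) (fun j => |v j| ^ 3 + |w j| ^ 3) ≤ Real.exp 4 * T := by
    intro s hs
    have := softAvg_le_exp_mul (β := β) (a := 2) (z := c s) (z' := z)
      (f := fun j => |v j| ^ 3 + |w j| ^ 3) (fun j => by positivity) (fun j => by
        have : β * c s j - β * z j = s * (β * v j) := by simp only [c]; ring
        rw [this, abs_mul, abs_of_nonneg hs.1]
        nlinarith [hv j, hs.2, hs.1, abs_nonneg (β * v j)])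
    norm_num at this
    exact this
  have hH : ∀ s ∈ Set.Icc (0 : ℝ) 1, |H s - H 0| ≤ K := by
    choose d hd hb using fun s => exists_hasDerivAt_hessForm hβ h₁ h₂ b₁ b₂ b₃ w (hc s)
    intro s hs
    have hs' : Set.Icc (0 : ℝ) s ⊆ Set.Icc 0 1 := Set.Icc_subset_Icc_right hs.2
    have := norm_image_sub_le_of_norm_deriv_le_segment' (f := H) (f' := d) (C := K) (a := 0)
      (b := s) (fun x hx => (hd x).hasDerivWithinAt) (fun x hx => by
        rw [Real.norm_eq_abs]
        refine (hb x).trans ?_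
        calc _ ≤ 8 * (G₃ + G₂ * β + G₁ * β ^ 2) * (Real.exp 4 * T) := by
              gcongr
              exact hT x (hs' (Set.Ico_subset_Icc_self hx))
          _ = K := by rw [hK]; ring) s ⟨hs.1, le_rfl⟩
    rw [Real.norm_eq_abs] at this
    have hK0 : 0 ≤ K := by
      have : 0 ≤ T := softAvg_nonneg β _ fun j => by positivity
      positivity
    nlinarith [hs.1, hs.2]
  have hψ : ∀ s, HasDerivAt (fun s => g₁ (smoothMax β (c s)) * softAvg β (c s) w - s * H 0)
      (H s - H 0) s := fun s =>
    ((hasDerivAt_grad_smoothMax hβ.ne' h₁ w (hc s)).sub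
      ((hasDerivAt_id s).mul_const (H 0))).congr_deriv (by simp [H])
  have := norm_image_sub_le_of_norm_deriv_le_segment_01' (C := K)
    (fun x hx => (hψ x).hasDerivWithinAt) (fun x hx => hH x (Set.Ico_subset_Icc_self hx))
  rw [Real.norm_eq_abs] at this
  simp only [c1, c0, H] at this
  convert this using 2
  ring

end softmax

/-! ### Continuity and integration of softmax averages -/

section measurability

variable {p : ℕ}

@[fun_prop]
lemma continuous_expSum (β : ℝ) : Continuous (expSum β : (Fin p → ℝ) → ℝ) := by
  unfold expSum; fun_prop

lemma continuous_smoothMax [NeZero p] (β : ℝ) : Continuous (smoothMax β : (Fin p → ℝ) → ℝ) :=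
  continuous_const.mul ((continuous_expSum β).log fun z => (expSum_pos β z).ne')

lemma continuous_softAvg [NeZero p] (β : ℝ) :
    Continuous fun q : (Fin p → ℝ) × (Fin p → ℝ) => softAvg β q.1 q.2 := by
  unfold softAvg
  refine Continuous.div (by fun_prop) (by fun_prop) fun q => (expSum_pos β q.1).ne'

lemma continuous_grad [NeZero p] (β : ℝ) {g₁ : ℝ → ℝ} (hg : Continuous g₁) :
    Continuous fun q : (Fin p → ℝ) × (Fin p → ℝ) => g₁ (smoothMax β q.1) * softAvg β q.1 q.2 :=
  (hg.comp ((continuous_smoothMax β).comp continuous_fst)).mul (continuous_softAvg β)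

lemma measurable_grad [NeZero p] (β : ℝ) {g₁ : ℝ → ℝ} (hg : Continuous g₁) {Ω : Type*}
    [MeasurableSpace Ω] {a b : Ω → Fin p → ℝ} (ha : Measurable a) (hb : Measurable b) :
    Measurable fun ω => g₁ (smoothMax β (a ω)) * softAvg β (a ω) (b ω) :=
  (continuous_grad β hg).measurable.comp (ha.prodMk hb)

lemma integral_softAvg {Ω : Type*} [MeasurableSpace Ω] {P : Measure Ω} (β : ℝ) (z : Fin p → ℝ)
    {f : Ω → Fin p → ℝ} (hf : ∀ j, Integrable (fun ω => f ω j) P) :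
    ∫ ω, softAvg β z (f ω) ∂P = softAvg β z (fun j => ∫ ω, f ω j ∂P) := by
  simp only [softAvg]
  rw [integral_div, integral_finsetSum _ fun j _ => (hf j).const_mul _]
  simp only [integral_const_mul]

lemma integrable_softAvg {Ω : Type*} [MeasurableSpace Ω] {P : Measure Ω} (β : ℝ) (z : Fin p → ℝ)
    {f : Ω → Fin p → ℝ} (hf : ∀ j, Integrable (fun ω => f ω j) P) :
    Integrable (fun ω => softAvg β z (f ω)) P :=
  (integrable_finsetSum _ fun j _ => (hf j).const_mul _).div_const _

lemma softAvg_mul_softAvg (β : ℝ) (z v w : Fin p → ℝ) :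
    softAvg β z v * softAvg β z w = softAvg β z (fun j => softAvg β z (fun k => v j * w k)) := by
  simp only [softAvg_const_mul]
  rw [mul_comm, ← softAvg_const_mul]
  simp only [mul_comm]

end measurability

/-! ### Conditioning on an independent variable -/

/-- Conditioning on one of two independent variables: a bound for the mean of `f (R, ·)` at every
frozen value of `R` integrates to a bound for the mean of `f (R, Q)`. -/
lemma abs_integral_le_of_indepFun {Ω A B : Type*} [MeasurableSpace Ω] [MeasurableSpace A]
    [MeasurableSpace B] {P : Measure Ω} [IsProbabilityMeasure P] {R : Ω → A} {Q : Ω → B}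
    (hR : Measurable R) (hQ : Measurable Q) (h : IndepFun R Q P) {f : A → B → ℝ}
    (hf : Measurable fun q : A × B => f q.1 q.2) {M : ℝ}
    (hM : ∀ ω ω', |f (R ω) (Q ω')| ≤ M) {D : A → ℝ} (hD : Integrable (fun ω => D (R ω)) P)
    (hfD : ∀ ω, |∫ ω', f (R ω) (Q ω') ∂P| ≤ D (R ω)) :
    |∫ ω, f (R ω) (Q ω) ∂P| ≤ ∫ ω, D (R ω) ∂P := by
  have hm := h.map_prod_eq_prod_map_map hR.aemeasurable hQ.aemeasurable
  rw [Measure.map_prod_map _ _ hR hQ] at hm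
  have hmeas : Measurable fun q : Ω × Ω => f (R q.1) (Q q.2) :=
    hf.comp ((hR.comp measurable_fst).prodMk (hQ.comp measurable_snd))
  have e : ∫ ω, f (R ω) (Q ω) ∂P = ∫ q : Ω × Ω, f (R q.1) (Q q.2) ∂(P.prod P) := by
    have e₁ := integral_map (hR.prodMk hQ).aemeasurable (μ := P)
      (f := fun q : A × B => f q.1 q.2) hf.aestronglyMeasurable
    have e₂ := integral_map (φ := Prod.map R Q) (μ := P.prod P)
      ((hR.comp measurable_fst).prodMk (hQ.comp measurable_snd)).aemeasurable
      (f := fun q : A × B => f q.1 q.2) hf.aestronglyMeasurable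
    rw [← hm] at e₂
    exact e₁.symm.trans e₂
  have hint : Integrable (fun q : Ω × Ω => f (R q.1) (Q q.2)) (P.prod P) :=
    Integrable.of_bound hmeas.aestronglyMeasurable M (ae_of_all _ fun q => by
      simpa using hM q.1 q.2)
  rw [e, integral_prod _ hint]
  refine (abs_integral_le_integral_abs).trans (integral_mono_ae ?_ hD (ae_of_all _ hfD))
  exact hint.integral_prod_left.abs

/-! ### Rotated pairs of uncorrelated variables -/

section rotation

variable {Ω : Type*} [MeasurableSpace Ω] {P : Measure Ω}

lemma integrable_rotation_mul {a a' b b' : Ω → ℝ} (s c : ℝ)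
    (h₁ : Integrable (fun ω => a ω * a' ω) P) (h₂ : Integrable (fun ω => b ω * b' ω) P)
    (h₃ : Integrable (fun ω => a' ω * b ω) P) (h₄ : Integrable (fun ω => a ω * b' ω) P) :
    Integrable (fun ω => (s * a ω + c * b ω) * (c * a' ω - s * b' ω)) P := by
  refine ((((h₁.const_mul (s * c)).sub (h₂.const_mul (s * c))).add
    (h₃.const_mul (c ^ 2))).sub (h₄.const_mul (s ^ 2))).congr (ae_of_all _ fun ω => ?_)
  simp only [Pi.add_apply, Pi.sub_apply]
  ring

/-- For uncorrelated pairs, the cross moment of a rotated pair only sees the difference of the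
covariances. -/
lemma integral_rotation_mul {a a' b b' : Ω → ℝ} (s c : ℝ)
    (h₁ : Integrable (fun ω => a ω * a' ω) P) (h₂ : Integrable (fun ω => b ω * b' ω) P)
    (h₃ : Integrable (fun ω => a' ω * b ω) P) (h₄ : Integrable (fun ω => a ω * b' ω) P)
    (e₃ : ∫ ω, a' ω * b ω ∂P = 0) (e₄ : ∫ ω, a ω * b' ω ∂P = 0) :
    ∫ ω, (s * a ω + c * b ω) * (c * a' ω - s * b' ω) ∂P
      = s * c * (∫ ω, a ω * a' ω ∂P - ∫ ω, b ω * b' ω ∂P) := by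
  have i₁ : Integrable (fun ω => s * c * (a ω * a' ω)) P := h₁.const_mul _
  have i₂ : Integrable (fun ω => s * c * (b ω * b' ω)) P := h₂.const_mul _
  have i₃ : Integrable (fun ω => c ^ 2 * (a' ω * b ω)) P := h₃.const_mul _
  have i₄ : Integrable (fun ω => s ^ 2 * (a ω * b' ω)) P := h₄.const_mul _
  have e : ∀ ω, (s * a ω + c * b ω) * (c * a' ω - s * b' ω)
      = s * c * (a ω * a' ω) - s * c * (b ω * b' ω)
        + (c ^ 2 * (a' ω * b ω) - s ^ 2 * (a ω * b' ω)) := fun ω => by ring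
  simp only [e]
  rw [integral_add (by exact i₁.sub i₂) (by exact i₃.sub i₄), integral_sub i₁ i₂,
    integral_sub i₃ i₄]
  simp only [integral_const_mul, e₃, e₄]
  ring

end rotation

/-! ### The contribution of one pair of summands -/

section step

variable {p : ℕ} {Ω : Type*} [MeasurableSpace Ω] {P : Measure Ω} [IsProbabilityMeasure P]

/-- The bound, as a function of the sum `z` of the other summands, for the contribution of one
summand to the derivative of the interpolation: `m` bounds third moments and `δ` bounds
differences of covariances. The constant `64` is the factor `8` of the third differential times the
factor `8` lost in passing from a rotated pair to the original one; `exp 4` is the price of moving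
the intermediate point of Taylor's formula to `z`. -/
noncomputable def stepBound (β G₁ G₂ G₃ : ℝ) (m : Fin p → ℝ) (δ : Fin p → Fin p → ℝ)
    (z : Fin p → ℝ) : ℝ :=
  64 * Real.exp 4 * (G₃ + G₂ * β + G₁ * β ^ 2) * softAvg β z m
    + (G₂ + β * G₁) * softAvg β z (fun j => softAvg β z (δ j))
    + β * G₁ * softAvg β z (fun j => δ j j)

/-- `stepBound` changes by a constant factor when a bounded summand is added to `z`. The exponent
`8` comes from the terms with two softmax weights. -/
lemma stepBound_le [NeZero p] {β G₁ G₂ G₃ : ℝ} (hβ : 0 < β) (n₁ : 0 ≤ G₁) (n₂ : 0 ≤ G₂)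
    (n₃ : 0 ≤ G₃) {m : Fin p → ℝ} {δ : Fin p → Fin p → ℝ} (hm : ∀ j, 0 ≤ m j)
    (hδ : ∀ j k, 0 ≤ δ j k) {z z' : Fin p → ℝ} (h : ∀ j, |β * z j - β * z' j| ≤ 2) :
    stepBound β G₁ G₂ G₃ m δ z ≤ Real.exp 8 * stepBound β G₁ G₂ G₃ m δ z' := by
  have key : ∀ f : Fin p → ℝ, (∀ j, 0 ≤ f j) → softAvg β z f ≤ Real.exp 4 * softAvg β z' f := by
    intro f hf
    have := softAvg_le_exp_mul hf h
    norm_num at this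
    exact this
  have h48 : Real.exp 4 ≤ Real.exp 8 := Real.exp_le_exp.2 (by norm_num)
  have k₁ : softAvg β z m ≤ Real.exp 8 * softAvg β z' m :=
    (key m hm).trans (mul_le_mul_of_nonneg_right h48 (softAvg_nonneg β _ hm))
  have k₂ : softAvg β z (fun j => δ j j) ≤ Real.exp 8 * softAvg β z' (fun j => δ j j) :=
    (key _ fun j => hδ j j).trans
      (mul_le_mul_of_nonneg_right h48 (softAvg_nonneg β _ fun j => hδ j j))
  have k₃ : softAvg β z (fun j => softAvg β z (δ j))
      ≤ Real.exp 8 * softAvg β z' (fun j => softAvg β z' (δ j)) := by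
    calc _ ≤ softAvg β z (fun j => Real.exp 4 * softAvg β z' (δ j)) :=
          softAvg_mono β z fun j => key _ (hδ j)
      _ ≤ Real.exp 4 * softAvg β z' (fun j => Real.exp 4 * softAvg β z' (δ j)) :=
          key _ fun j => mul_nonneg (Real.exp_pos _).le (softAvg_nonneg β _ (hδ j))
      _ = Real.exp 8 * softAvg β z' (fun j => softAvg β z' (δ j)) := by
          rw [softAvg_const_mul, ← mul_assoc, ← Real.exp_add]; norm_num
  unfold stepBound
  calc _ ≤ 64 * Real.exp 4 * (G₃ + G₂ * β + G₁ * β ^ 2) * (Real.exp 8 * softAvg β z' m)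
        + (G₂ + β * G₁) * (Real.exp 8 * softAvg β z' (fun j => softAvg β z' (δ j)))
        + β * G₁ * (Real.exp 8 * softAvg β z' (fun j => δ j j)) := by gcongr
    _ = _ := by ring

lemma stepBound_sum {n : ℕ} (β G₁ G₂ G₃ : ℝ) (m : Fin n → Fin p → ℝ)
    (δ : Fin n → Fin p → Fin p → ℝ) (z : Fin p → ℝ) :
    ∑ i, stepBound β G₁ G₂ G₃ (m i) (δ i) z
      = stepBound β G₁ G₂ G₃ (fun j => ∑ i, m i j) (fun j k => ∑ i, δ i j k) z := by
  simp only [stepBound, Finset.sum_add_distrib, ← Finset.mul_sum, softAvg_sum]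

lemma stepBound_le_const [NeZero p] {β G₁ G₂ G₃ K₂ K₃ : ℝ} (hβ : 0 < β) (n₁ : 0 ≤ G₁)
    (n₂ : 0 ≤ G₂) (n₃ : 0 ≤ G₃) {m : Fin p → ℝ} {δ : Fin p → Fin p → ℝ}
    (hm : ∀ j, m j ≤ K₃) (hδ : ∀ j k, δ j k ≤ K₂) (z : Fin p → ℝ) :
    stepBound β G₁ G₂ G₃ m δ z
      ≤ 64 * Real.exp 4 * (G₃ + G₂ * β + G₁ * β ^ 2) * K₃ + (G₂ + β * G₁) * K₂ + β * G₁ * K₂ := by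
  unfold stepBound
  gcongr
  · exact softAvg_le_of_le β z hm
  · exact softAvg_le_of_le β z fun j => softAvg_le_of_le β z (hδ j)
  · exact softAvg_le_of_le β z fun j => hδ j j

lemma continuous_stepBound [NeZero p] (β G₁ G₂ G₃ : ℝ) (m : Fin p → ℝ)
    (δ : Fin p → Fin p → ℝ) : Continuous (stepBound β G₁ G₂ G₃ m δ) := by
  have h : ∀ f : (Fin p → ℝ) → Fin p → ℝ, Continuous f → Continuous fun z => softAvg β z (f z) :=
    fun f hf => (continuous_softAvg β).comp (continuous_id.prodMk hf)
  unfold stepBound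
  exact (((continuous_const.mul (h _ continuous_const)).add
    (continuous_const.mul (h _ (continuous_pi fun j => h _ continuous_const)))).add
    (continuous_const.mul (h _ continuous_const)))

lemma abs_pow_three_add_le {s c a b : ℝ} (hs : |s| ≤ 1) (hc : |c| ≤ 1) :
    |s * a + c * b| ^ 3 + |c * a - s * b| ^ 3 ≤ 8 * (|a| ^ 3 + |b| ^ 3) := by
  have ha := abs_nonneg a
  have hb := abs_nonneg b
  have h : ∀ x y : ℝ, |x| ≤ 1 → |y| ≤ 1 → |x * a + y * b| ^ 3 ≤ (|a| + |b|) ^ 3 := by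
    intro x y hx hy
    gcongr
    calc |x * a + y * b| ≤ |x| * |a| + |y| * |b| := by
          rw [← abs_mul, ← abs_mul]; exact abs_add_le _ _
      _ ≤ 1 * |a| + 1 * |b| := by gcongr
      _ = _ := by ring
  have h1 := h s c hs hc
  have h2 := h c (-s) hc (by rwa [abs_neg])
  rw [neg_mul, ← sub_eq_add_neg] at h2
  have h3 : (|a| + |b|) ^ 3 ≤ 4 * (|a| ^ 3 + |b| ^ 3) := by
    nlinarith [mul_nonneg (add_nonneg ha hb) (sq_nonneg (|a| - |b|))]
  linarith

/-- The contribution of one summand pair `(x, y)`, the sum of the others being frozen at `z`: the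
zeroth-order Taylor term has mean zero, the first-order one sees only the covariance mismatch,
and the remainder is of third order. -/
lemma abs_integral_step_le [NeZero p] {β b : ℝ} (hβ : 0 < β) (hb : β * b ≤ 1)
    {g₁ g₂ g₃ : ℝ → ℝ} {G₁ G₂ G₃ : ℝ}
    (h₁ : ∀ t, HasDerivAt g₁ (g₂ t) t) (h₂ : ∀ t, HasDerivAt g₂ (g₃ t) t)
    (b₁ : ∀ t, |g₁ t| ≤ G₁) (b₂ : ∀ t, |g₂ t| ≤ G₂) (b₃ : ∀ t, |g₃ t| ≤ G₃)
    {x y : Ω → Fin p → ℝ} (hx : Measurable x) (hy : Measurable y)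
    (bx : ∀ ω j, |x ω j| ≤ b) (bY : ∀ ω j, |y ω j| ≤ b)
    (ex : ∀ j, ∫ ω, x ω j ∂P = 0) (ey : ∀ j, ∫ ω, y ω j ∂P = 0)
    (exy : ∀ j k, ∫ ω, x ω j * y ω k ∂P = 0) {s c : ℝ} (hs : |s| ≤ 1) (hc : |c| ≤ 1)
    (z : Fin p → ℝ) :
    |∫ ω, g₁ (smoothMax β (z + (s • x ω + c • y ω)))
        * softAvg β (z + (s • x ω + c • y ω)) (c • x ω - s • y ω) ∂P|
      ≤ stepBound β G₁ G₂ G₃ (fun j => ∫ ω, (|x ω j| ^ 3 + |y ω j| ^ 3) ∂P)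
          (fun j k => |∫ ω, x ω j * x ω k ∂P - ∫ ω, y ω j * y ω k ∂P|) z := by
  have n₁ : 0 ≤ G₁ := (abs_nonneg _).trans (b₁ 0)
  have n₂ : 0 ≤ G₂ := (abs_nonneg _).trans (b₂ 0)
  have n₃ : 0 ≤ G₃ := (abs_nonneg _).trans (b₃ 0)
  have mx : ∀ j, Measurable fun ω => x ω j := fun j => (measurable_pi_apply j).comp hx
  have my : ∀ j, Measurable fun ω => y ω j := fun j => (measurable_pi_apply j).comp hy
  have b0 : 0 ≤ b := by
    obtain ⟨ω⟩ : Nonempty Ω := nonempty_of_isProbabilityMeasure P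
    exact (abs_nonneg _).trans (bx ω 0)
  have ix : ∀ j, Integrable (fun ω => x ω j) P := fun j =>
    Integrable.of_bound (mx j).aestronglyMeasurable b (ae_of_all _ fun ω => bx ω j)
  have iy : ∀ j, Integrable (fun ω => y ω j) P := fun j =>
    Integrable.of_bound (my j).aestronglyMeasurable b (ae_of_all _ fun ω => bY ω j)
  have imul : ∀ f h : Ω → ℝ, Measurable f → Measurable h → (∀ ω, |f ω| ≤ b) → (∀ ω, |h ω| ≤ b) →
      Integrable (fun ω => f ω * h ω) P := fun f h mf mh bf bh =>
    Integrable.of_bound (mf.mul mh).aestronglyMeasurable (b * b) (ae_of_all _ fun ω => by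
      rw [Real.norm_eq_abs, abs_mul]
      exact mul_le_mul (bf ω) (bh ω) (abs_nonneg _) b0)
  have icube : ∀ f : Ω → ℝ, Measurable f → (∀ ω, |f ω| ≤ b) →
      Integrable (fun ω => |f ω| ^ 3) P := fun f mf bf =>
    Integrable.of_bound (mf.abs.pow_const 3).aestronglyMeasurable (b ^ 3) (ae_of_all _ fun ω => by
      rw [Real.norm_eq_abs, abs_of_nonneg (by positivity)]
      gcongr
      exact bf ω)
  let v : Ω → Fin p → ℝ := fun ω j => s * x ω j + c * y ω j
  let w : Ω → Fin p → ℝ := fun ω j => c * x ω j - s * y ω j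
  have hv : ∀ ω, s • x ω + c • y ω = v ω := fun ω => rfl
  have hw : ∀ ω, c • x ω - s • y ω = w ω := fun ω => rfl
  have mv : Measurable v := measurable_pi_lambda _ fun j => by
    have := mx j; have := my j; fun_prop
  have mw : Measurable w := measurable_pi_lambda _ fun j => by
    have := mx j; have := my j; fun_prop
  have bv : ∀ ω j, |v ω j| ≤ 2 * b := fun ω j => by
    calc |v ω j| ≤ |s| * |x ω j| + |c| * |y ω j| := by
          rw [← abs_mul, ← abs_mul]; exact abs_add_le _ _
      _ ≤ 1 * b + 1 * b := by gcongr; exacts [bx ω j, bY ω j]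
      _ = _ := by ring
  have iw : ∀ j, Integrable (fun ω => w ω j) P := fun j =>
    ((ix j).const_mul c).sub ((iy j).const_mul s)
  have ew : ∀ j, ∫ ω, w ω j ∂P = 0 := fun j => by
    simp only [w]
    rw [integral_sub ((ix j).const_mul c) ((iy j).const_mul s), integral_const_mul,
      integral_const_mul, ex, ey]
    ring
  have ixx := fun j k => imul _ _ (mx j) (mx k) (bx · j) (bx · k)
  have iyy := fun j k => imul _ _ (my j) (my k) (bY · j) (bY · k)
  have ixy := fun j k => imul _ _ (mx j) (my k) (bx · j) (bY · k)
  have ivw : ∀ j k, Integrable (fun ω => v ω j * w ω k) P := fun j k =>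
    integrable_rotation_mul s c (ixx j k) (iyy j k) (ixy k j) (ixy j k)
  have evw : ∀ j k, ∫ ω, v ω j * w ω k ∂P
      = s * c * (∫ ω, x ω j * x ω k ∂P - ∫ ω, y ω j * y ω k ∂P) := fun j k =>
    integral_rotation_mul s c (ixx j k) (iyy j k) (ixy k j) (ixy j k) (exy k j) (exy j k)
  have bvw : ∀ j k, |∫ ω, v ω j * w ω k ∂P|
      ≤ |∫ ω, x ω j * x ω k ∂P - ∫ ω, y ω j * y ω k ∂P| := fun j k => by
    rw [evw, abs_mul, abs_mul]
    exact mul_le_of_le_one_left (abs_nonneg _) (mul_le_one₀ hs (abs_nonneg _) hc)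
  simp only [hv, hw]
  set d₁ := g₁ (smoothMax β z)
  set d₂ := g₂ (smoothMax β z)
  set δ : Fin p → Fin p → ℝ := fun j k => |∫ ω, x ω j * x ω k ∂P - ∫ ω, y ω j * y ω k ∂P|
  set m : Fin p → ℝ := fun j => ∫ ω, (|x ω j| ^ 3 + |y ω j| ^ 3) ∂P
  -- the Hessian term, rewritten as a linear functional of the products `v j * w k`
  have hform : ∀ ω, hessForm β d₁ d₂ z (v ω) (w ω)
      = (d₂ - d₁ * β) * softAvg β z (fun j => softAvg β z (fun k => v ω j * w ω k))
        + d₁ * β * softAvg β z (fun j => v ω j * w ω j) := fun ω => by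
    rw [← softAvg_mul_softAvg, hessForm]
    simp only [mul_comm (w ω _)]
    ring
  have iD := fun j => integrable_softAvg β z (f := fun ω k => v ω j * w ω k) (P := P) (ivw j)
  have iDD := integrable_softAvg β z (P := P) iD
  have iDj := integrable_softAvg β z (f := fun ω j => v ω j * w ω j) (P := P) fun j => ivw j j
  have iH : Integrable (fun ω => hessForm β d₁ d₂ z (v ω) (w ω)) P := by
    simp only [hform]
    exact (iDD.const_mul _).add (iDj.const_mul _)
  have eH : |∫ ω, hessForm β d₁ d₂ z (v ω) (w ω) ∂P|
      ≤ (G₂ + β * G₁) * softAvg β z (fun j => softAvg β z (δ j))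
        + β * G₁ * softAvg β z (fun j => δ j j) := by
    simp only [hform]
    rw [integral_add (iDD.const_mul _) (iDj.const_mul _), integral_const_mul, integral_const_mul,
      integral_softAvg β z iD, integral_softAvg β z fun j => ivw j j]
    simp only [fun j => integral_softAvg β z (f := fun ω k => v ω j * w ω k) (P := P) (ivw j)]
    refine (abs_add_le _ _).trans (add_le_add ?_ ?_)
    · rw [abs_mul]
      refine mul_le_mul ?_ ?_ (abs_nonneg _) (by positivity)
      · refine (abs_sub _ _).trans ?_
        rw [abs_mul, abs_of_pos hβ, mul_comm]
        gcongr
        exacts [b₂ _, b₁ _]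
      · exact abs_softAvg_le β z fun j => abs_softAvg_le β z fun k => bvw j k
    · rw [abs_mul, abs_mul, abs_of_pos hβ, mul_comm |d₁|]
      refine mul_le_mul (by gcongr; exact b₁ _) ?_ (abs_nonneg _) (by positivity)
      exact abs_softAvg_le β z fun k => bvw k k
  have i0 : Integrable (fun ω => d₁ * softAvg β z (w ω)) P :=
    (integrable_softAvg β z iw).const_mul _
  have e0 : ∫ ω, d₁ * softAvg β z (w ω) ∂P = 0 := by
    rw [integral_const_mul, integral_softAvg β z iw]
    simp only [ew, softAvg_const, mul_zero]
  have im : ∀ j, Integrable (fun ω => |x ω j| ^ 3 + |y ω j| ^ 3) P := fun j =>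
    (icube _ (mx j) (bx · j)).add (icube _ (my j) (bY · j))
  -- the Taylor remainder
  have rem : ∀ ω, |g₁ (smoothMax β (z + v ω)) * softAvg β (z + v ω) (w ω)
      - d₁ * softAvg β z (w ω) - hessForm β d₁ d₂ z (v ω) (w ω)|
      ≤ 64 * Real.exp 4 * (G₃ + G₂ * β + G₁ * β ^ 2)
        * softAvg β z (fun j => |x ω j| ^ 3 + |y ω j| ^ 3) := fun ω => by
    refine (abs_grad_taylor_le hβ h₁ h₂ b₁ b₂ b₃ z (v ω) (w ω) fun j => ?_).trans ?_
    · rw [abs_mul, abs_of_pos hβ]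
      nlinarith [bv ω j]
    · have hle : softAvg β z (fun j => |v ω j| ^ 3 + |w ω j| ^ 3)
          ≤ 8 * softAvg β z (fun j => |x ω j| ^ 3 + |y ω j| ^ 3) := by
        rw [← softAvg_const_mul]
        exact softAvg_mono β z fun j => abs_pow_three_add_le hs hc
      calc _ ≤ 8 * Real.exp 4 * (G₃ + G₂ * β + G₁ * β ^ 2)
            * (8 * softAvg β z (fun j => |x ω j| ^ 3 + |y ω j| ^ 3)) := by gcongr
        _ = _ := by ring
  have cg : Continuous g₁ := continuous_iff_continuousAt.2 fun t => (h₁ t).continuousAt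
  have iR₀ : Integrable (fun ω => 64 * Real.exp 4 * (G₃ + G₂ * β + G₁ * β ^ 2)
      * softAvg β z (fun j => |x ω j| ^ 3 + |y ω j| ^ 3)) P :=
    (integrable_softAvg β z im).const_mul _
  have mzv : Measurable fun ω => z + v ω := mv.const_add z
  have mΨ : Measurable fun ω => g₁ (smoothMax β (z + v ω)) * softAvg β (z + v ω) (w ω) :=
    measurable_grad β cg (a := fun ω => z + v ω) mzv mw
  have iR : Integrable (fun ω => g₁ (smoothMax β (z + v ω)) * softAvg β (z + v ω) (w ω)
      - d₁ * softAvg β z (w ω) - hessForm β d₁ d₂ z (v ω) (w ω)) P :=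
    iR₀.mono' ((mΨ.aestronglyMeasurable.sub i0.aestronglyMeasurable).sub iH.aestronglyMeasurable)
      (ae_of_all _ rem)
  have eR : |∫ ω, (g₁ (smoothMax β (z + v ω)) * softAvg β (z + v ω) (w ω)
      - d₁ * softAvg β z (w ω) - hessForm β d₁ d₂ z (v ω) (w ω)) ∂P|
      ≤ 64 * Real.exp 4 * (G₃ + G₂ * β + G₁ * β ^ 2) * softAvg β z m := by
    rw [← integral_softAvg β z im, ← integral_const_mul]
    exact abs_integral_le_integral_abs.trans
      (integral_mono_ae iR.abs iR₀ (ae_of_all _ rem))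
  have split : ∫ ω, g₁ (smoothMax β (z + v ω)) * softAvg β (z + v ω) (w ω) ∂P
      = ∫ ω, (g₁ (smoothMax β (z + v ω)) * softAvg β (z + v ω) (w ω)
        - d₁ * softAvg β z (w ω) - hessForm β d₁ d₂ z (v ω) (w ω)) ∂P
        + ∫ ω, hessForm β d₁ d₂ z (v ω) (w ω) ∂P := by
    have iS : Integrable (fun ω => hessForm β d₁ d₂ z (v ω) (w ω) + d₁ * softAvg β z (w ω)) P :=
      iH.add i0
    rw [← add_zero (∫ ω, hessForm β d₁ d₂ z (v ω) (w ω) ∂P), ← e0, ← integral_add iH i0,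
      ← integral_add iR iS]
    refine integral_congr_ae (ae_of_all _ fun ω => ?_)
    simp only
    ring
  rw [split, stepBound, add_assoc]
  exact (abs_add_le _ _).trans (add_le_add eR eH)

end step

/-! ### Interpolation along a quarter circle -/

lemma stepBound_nonneg {p : ℕ} [NeZero p] {β G₁ G₂ G₃ : ℝ} (hβ : 0 < β) (n₁ : 0 ≤ G₁)
    (n₂ : 0 ≤ G₂) (n₃ : 0 ≤ G₃) {m : Fin p → ℝ} {δ : Fin p → Fin p → ℝ} (hm : ∀ j, 0 ≤ m j)
    (hδ : ∀ j k, 0 ≤ δ j k) (z : Fin p → ℝ) : 0 ≤ stepBound β G₁ G₂ G₃ m δ z := by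
  have h₁ := softAvg_nonneg β z hm
  have h₂ := softAvg_nonneg β z fun j => softAvg_nonneg β z (hδ j)
  have h₃ := softAvg_nonneg β z fun j => hδ j j
  unfold stepBound
  positivity

section interpolation

variable {n p : ℕ} {Ω : Type*} [MeasurableSpace Ω] {P : Measure Ω} [IsProbabilityMeasure P]

lemma integrable_stepBound_comp [NeZero p] {β G₁ G₂ G₃ : ℝ} (hβ : 0 < β) (n₁ : 0 ≤ G₁)
    (n₂ : 0 ≤ G₂) (n₃ : 0 ≤ G₃) {m : Fin p → ℝ} {δ : Fin p → Fin p → ℝ} (hm : ∀ j, 0 ≤ m j)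
    (hδ : ∀ j k, 0 ≤ δ j k) {z : Ω → Fin p → ℝ} (hz : Measurable z) :
    Integrable (fun ω => stepBound β G₁ G₂ G₃ m δ (z ω)) P := by
  refine Integrable.of_bound
    ((continuous_stepBound β G₁ G₂ G₃ m δ).measurable.comp hz).aestronglyMeasurable
    (64 * Real.exp 4 * (G₃ + G₂ * β + G₁ * β ^ 2) * (∑ j, m j)
      + (G₂ + β * G₁) * (∑ j, ∑ k, δ j k) + β * G₁ * (∑ j, ∑ k, δ j k)) (ae_of_all _ fun ω => ?_)
  rw [Real.norm_eq_abs, abs_of_nonneg (stepBound_nonneg hβ n₁ n₂ n₃ hm hδ _)]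
  refine stepBound_le_const hβ n₁ n₂ n₃
    (fun j => Finset.single_le_sum (fun j _ => hm j) (Finset.mem_univ j)) (fun j k => ?_) _
  exact (Finset.single_le_sum (fun k _ => hδ j k) (Finset.mem_univ k)).trans
    (Finset.single_le_sum (f := fun j => ∑ k, δ j k)
      (fun j _ => Finset.sum_nonneg fun k _ => hδ j k) (Finset.mem_univ j))

/-- The contribution of the `i`-th pair to the derivative of the interpolation. The other pairs are
frozen by independence, and the bound is then transported back to the full sum. -/
lemma abs_integral_summand_le [NeZero p] {β b : ℝ} (hβ : 0 < β) (hb : β * b ≤ 1)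
    {g₁ g₂ g₃ : ℝ → ℝ} {G₁ G₂ G₃ : ℝ}
    (h₁ : ∀ t, HasDerivAt g₁ (g₂ t) t) (h₂ : ∀ t, HasDerivAt g₂ (g₃ t) t)
    (b₁ : ∀ t, |g₁ t| ≤ G₁) (b₂ : ∀ t, |g₂ t| ≤ G₂) (b₃ : ∀ t, |g₃ t| ≤ G₃)
    {x y : Fin n → Ω → Fin p → ℝ} (hx : ∀ i, Measurable (x i)) (hy : ∀ i, Measurable (y i))
    (hind : iIndepFun (fun i ω => (x i ω, y i ω)) P)
    (bx : ∀ i ω j, |x i ω j| ≤ b) (bY : ∀ i ω j, |y i ω j| ≤ b)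
    (ex : ∀ i j, ∫ ω, x i ω j ∂P = 0) (ey : ∀ i j, ∫ ω, y i ω j ∂P = 0)
    (exy : ∀ i j k, ∫ ω, x i ω j * y i ω k ∂P = 0) {s c : ℝ} (hs : |s| ≤ 1) (hc : |c| ≤ 1)
    (i : Fin n) :
    |∫ ω, g₁ (smoothMax β (s • (∑ k, x k ω) + c • ∑ k, y k ω))
        * softAvg β (s • (∑ k, x k ω) + c • ∑ k, y k ω) (c • x i ω - s • y i ω) ∂P|
      ≤ Real.exp 8 * ∫ ω, stepBound β G₁ G₂ G₃
          (fun j => ∫ ω, (|x i ω j| ^ 3 + |y i ω j| ^ 3) ∂P)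
          (fun j k => |∫ ω, x i ω j * x i ω k ∂P - ∫ ω, y i ω j * y i ω k ∂P|)
          (s • (∑ k, x k ω) + c • ∑ k, y k ω) ∂P := by
  have n₁ : 0 ≤ G₁ := (abs_nonneg _).trans (b₁ 0)
  have n₂ : 0 ≤ G₂ := (abs_nonneg _).trans (b₂ 0)
  have n₃ : 0 ≤ G₃ := (abs_nonneg _).trans (b₃ 0)
  set m : Fin p → ℝ := fun j => ∫ ω, (|x i ω j| ^ 3 + |y i ω j| ^ 3) ∂P
  set δ : Fin p → Fin p → ℝ :=
    fun j k => |∫ ω, x i ω j * x i ω k ∂P - ∫ ω, y i ω j * y i ω k ∂P|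
  have m0 : ∀ j, 0 ≤ m j := fun j => integral_nonneg fun ω => by positivity
  have δ0 : ∀ j k, 0 ≤ δ j k := fun j k => abs_nonneg _
  -- the sum of the other pairs
  let R : Ω → (Fin p → ℝ) × (Fin p → ℝ) := ∑ k ∈ Finset.univ.erase i, fun ω => (x k ω, y k ω)
  have hRdef : ∀ ω, R ω = (∑ k ∈ Finset.univ.erase i, x k ω, ∑ k ∈ Finset.univ.erase i, y k ω) :=
    fun ω => by simp [R, Finset.sum_apply, Prod.ext_iff, Prod.fst_sum, Prod.snd_sum]
  have hq : ∀ k, Measurable fun ω => (x k ω, y k ω) := fun k => (hx k).prodMk (hy k)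
  have hR : Measurable R := by
    rw [funext hRdef]
    exact (Finset.measurable_fun_sum _ fun k _ => hx k).prodMk
      (Finset.measurable_fun_sum _ fun k _ => hy k)
  have hRi : IndepFun R (fun ω => (x i ω, y i ω)) P :=
    hind.indepFun_finsetSum_of_notMem hq (Finset.notMem_erase i _)
  let L : (Fin p → ℝ) × (Fin p → ℝ) → Fin p → ℝ := fun q => s • q.1 + c • q.2
  let L' : (Fin p → ℝ) × (Fin p → ℝ) → Fin p → ℝ := fun q => c • q.1 - s • q.2
  have cL : Continuous L := by fun_prop
  have cL' : Continuous L' := by fun_prop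
  have bL : ∀ ω j, |L (x i ω, y i ω) j| ≤ 2 * b := fun ω j => by
    calc |s * x i ω j + c * y i ω j| ≤ |s| * |x i ω j| + |c| * |y i ω j| := by
          rw [← abs_mul, ← abs_mul]; exact abs_add_le _ _
      _ ≤ 1 * b + 1 * b := by gcongr; exacts [bx i ω j, bY i ω j]
      _ = _ := by ring
  have bL' : ∀ ω j, |L' (x i ω, y i ω) j| ≤ 2 * b := fun ω j => by
    calc |c * x i ω j - s * y i ω j| ≤ |c| * |x i ω j| + |s| * |y i ω j| := by
          rw [← abs_mul, ← abs_mul]; exact abs_sub _ _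
      _ ≤ 1 * b + 1 * b := by gcongr; exacts [bx i ω j, bY i ω j]
      _ = _ := by ring
  have hsum : ∀ ω, s • (∑ k, x k ω) + c • ∑ k, y k ω = L (R ω) + L (x i ω, y i ω) := fun ω => by
    rw [hRdef, ← Finset.add_sum_erase _ _ (Finset.mem_univ i),
      ← Finset.add_sum_erase _ (fun k => y k ω) (Finset.mem_univ i)]
    simp only [L, smul_add]
    abel
  have cg : Continuous g₁ := continuous_iff_continuousAt.2 fun t => (h₁ t).continuousAt
  have mA : Measurable fun r : ((Fin p → ℝ) × (Fin p → ℝ)) × ((Fin p → ℝ) × (Fin p → ℝ)) =>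
      L r.1 + L r.2 := by
    have := cL.measurable
    fun_prop
  have key := abs_integral_le_of_indepFun (P := P) hR (hq i) hRi
    (f := fun r q => g₁ (smoothMax β (L r + L q)) * softAvg β (L r + L q) (L' q))
    (measurable_grad β cg (a := fun r : ((Fin p → ℝ) × (Fin p → ℝ)) × _ => L r.1 + L r.2)
      (b := fun r => L' r.2) mA (cL'.measurable.comp measurable_snd))
    (M := G₁ * (2 * b)) (fun ω ω' => by
      rw [abs_mul]
      refine mul_le_mul (b₁ _) ?_ (abs_nonneg _) n₁
      have := abs_softAvg_le β (L (R ω) + L (x i ω', y i ω')) (h := fun _ => 2 * b) (bL' ω')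
      rwa [softAvg_const] at this)
    (D := fun r => stepBound β G₁ G₂ G₃ m δ (L r))
    (integrable_stepBound_comp hβ n₁ n₂ n₃ m0 δ0 (cL.measurable.comp hR))
    (fun ω => abs_integral_step_le hβ hb h₁ h₂ b₁ b₂ b₃ (hx i) (hy i) (bx i) (bY i) (ex i) (ey i)
      (exy i) hs hc (L (R ω)))
  have mZ : Measurable fun ω => L (R ω) + L (x i ω, y i ω) :=
    (cL.measurable.comp hR).add (cL.measurable.comp (hq i))
  simp only [hsum]
  refine key.trans ?_
  rw [← integral_const_mul]
  refine integral_mono (integrable_stepBound_comp hβ n₁ n₂ n₃ m0 δ0 (cL.measurable.comp hR))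
    ((integrable_stepBound_comp hβ n₁ n₂ n₃ m0 δ0 mZ).const_mul _) fun ω => ?_
  refine stepBound_le hβ n₁ n₂ n₃ m0 δ0 fun j => ?_
  rw [Pi.add_apply, show ∀ u v : ℝ, β * u - β * (u + v) = -(β * v) from fun u v => by ring, abs_neg,
    abs_mul, abs_of_pos hβ]
  nlinarith [bL ω j]

/-- Comparison of two sums of bounded independent summands by interpolation along a quarter circle:
the third moments and the covariance mismatch are the only features of the summands that enter. -/
theorem abs_integral_smoothMax_sub_le [NeZero p] {β b : ℝ} (hβ : 0 < β) (hb : β * b ≤ 1)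
    {g g₁ g₂ g₃ : ℝ → ℝ} {G₀ G₁ G₂ G₃ : ℝ} (h₀ : ∀ t, HasDerivAt g (g₁ t) t)
    (h₁ : ∀ t, HasDerivAt g₁ (g₂ t) t) (h₂ : ∀ t, HasDerivAt g₂ (g₃ t) t)
    (b₀ : ∀ t, |g t| ≤ G₀)
    (b₁ : ∀ t, |g₁ t| ≤ G₁) (b₂ : ∀ t, |g₂ t| ≤ G₂) (b₃ : ∀ t, |g₃ t| ≤ G₃)
    {x y : Fin n → Ω → Fin p → ℝ} (hx : ∀ i, Measurable (x i)) (hy : ∀ i, Measurable (y i))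
    (hind : iIndepFun (fun i ω => (x i ω, y i ω)) P)
    (bx : ∀ i ω j, |x i ω j| ≤ b) (bY : ∀ i ω j, |y i ω j| ≤ b)
    (ex : ∀ i j, ∫ ω, x i ω j ∂P = 0) (ey : ∀ i j, ∫ ω, y i ω j ∂P = 0)
    (exy : ∀ i j k, ∫ ω, x i ω j * y i ω k ∂P = 0) {K₂ K₃ : ℝ}
    (hK₃ : ∀ j, ∑ i, ∫ ω, (|x i ω j| ^ 3 + |y i ω j| ^ 3) ∂P ≤ K₃)
    (hK₂ : ∀ j k, ∑ i, |∫ ω, x i ω j * x i ω k ∂P - ∫ ω, y i ω j * y i ω k ∂P| ≤ K₂) :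
    |∫ ω, g (smoothMax β (∑ i, x i ω)) ∂P - ∫ ω, g (smoothMax β (∑ i, y i ω)) ∂P|
      ≤ 128 * Real.exp 12 * ((G₃ + G₂ * β + G₁ * β ^ 2) * K₃ + (G₂ + β * G₁) * K₂) := by
  have n₁ : 0 ≤ G₁ := (abs_nonneg _).trans (b₁ 0)
  have n₂ : 0 ≤ G₂ := (abs_nonneg _).trans (b₂ 0)
  have n₃ : 0 ≤ G₃ := (abs_nonneg _).trans (b₃ 0)
  have nK₂ : 0 ≤ K₂ := (Finset.sum_nonneg fun i _ => abs_nonneg _).trans (hK₂ 0 0)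
  have nK₃ : 0 ≤ K₃ :=
    (Finset.sum_nonneg fun i _ => integral_nonneg fun ω => by positivity).trans (hK₃ 0)
  let Z : ℝ → Ω → Fin p → ℝ :=
    fun θ ω => Real.sin θ • (∑ i, x i ω) + Real.cos θ • ∑ i, y i ω
  let W : ℝ → Fin n → Ω → Fin p → ℝ := fun θ i ω => Real.cos θ • x i ω - Real.sin θ • y i ω
  have hW : ∀ θ ω j, ∑ i, W θ i ω j
      = Real.cos θ * (∑ i, x i ω) j - Real.sin θ * (∑ i, y i ω) j := fun θ ω j => by
    simp [W, Finset.sum_apply, Finset.sum_sub_distrib, Finset.mul_sum]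
  have mX : Measurable fun ω => ∑ i, x i ω := Finset.measurable_fun_sum _ fun i _ => hx i
  have mY : Measurable fun ω => ∑ i, y i ω := Finset.measurable_fun_sum _ fun i _ => hy i
  have mZ : ∀ θ, Measurable (Z θ) := fun θ =>
    (mX.const_smul (Real.sin θ)).add (mY.const_smul (Real.cos θ))
  have mW : ∀ θ i, Measurable (W θ i) := fun θ i =>
    ((hx i).const_smul (Real.cos θ)).sub ((hy i).const_smul (Real.sin θ))
  have bW : ∀ θ i ω j, |W θ i ω j| ≤ 2 * b := fun θ i ω j => by
    calc |Real.cos θ * x i ω j - Real.sin θ * y i ω j|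
        ≤ |Real.cos θ| * |x i ω j| + |Real.sin θ| * |y i ω j| := by
          rw [← abs_mul, ← abs_mul]; exact abs_sub _ _
      _ ≤ 1 * b + 1 * b := by
          gcongr
          exacts [Real.abs_cos_le_one θ, bx i ω j, Real.abs_sin_le_one θ, bY i ω j]
      _ = _ := by ring
  have cg : Continuous g := continuous_iff_continuousAt.2 fun t => (h₀ t).continuousAt
  have cg₁ : Continuous g₁ := continuous_iff_continuousAt.2 fun t => (h₁ t).continuousAt
  let ψ : ℝ → Fin n → Ω → ℝ :=
    fun θ i ω => g₁ (smoothMax β (Z θ ω)) * softAvg β (Z θ ω) (W θ i ω)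
  have bψ : ∀ θ i ω, |ψ θ i ω| ≤ G₁ * (2 * b) := fun θ i ω => by
    rw [abs_mul]
    refine mul_le_mul (b₁ _) ?_ (abs_nonneg _) n₁
    have := abs_softAvg_le β (Z θ ω) (h := fun _ => 2 * b) (bW θ i ω)
    rwa [softAvg_const] at this
  have mψ : ∀ θ i, Measurable (ψ θ i) := fun θ i => measurable_grad β cg₁ (mZ θ) (mW θ i)
  have iψ : ∀ θ i, Integrable (ψ θ i) P := fun θ i =>
    Integrable.of_bound (mψ θ i).aestronglyMeasurable _ (ae_of_all _ (bψ θ i))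
  have mG : ∀ θ, AEStronglyMeasurable (fun ω => g (smoothMax β (Z θ ω))) P := fun θ =>
    ((cg.comp (continuous_smoothMax β)).measurable.comp (mZ θ)).aestronglyMeasurable
  have dΦ : ∀ θ, HasDerivAt (fun θ => ∫ ω, g (smoothMax β (Z θ ω)) ∂P)
      (∫ ω, ∑ i, ψ θ i ω ∂P) θ := fun θ => by
    refine (hasDerivAt_integral_of_dominated_loc_of_deriv_le
      (F := fun θ ω => g (smoothMax β (Z θ ω))) (F' := fun θ ω => ∑ i, ψ θ i ω)
      (s := Set.univ) (bound := fun _ => ∑ _i : Fin n, G₁ * (2 * b)) Filter.univ_mem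
      (Filter.Eventually.of_forall mG)
      (Integrable.of_bound (mG θ) G₀ (ae_of_all _ fun ω => b₀ _))
      (Finset.measurable_fun_sum _ fun i _ => mψ θ i).aestronglyMeasurable
      (ae_of_all _ fun ω θ' _ => ?_) (integrable_const _) (ae_of_all _ fun ω θ' _ => ?_)).2
    · exact (Finset.abs_sum_le_sum_abs _ _).trans (Finset.sum_le_sum fun i _ => bψ θ' i ω)
    · have hc : ∀ j, HasDerivAt (fun t => Z t ω j) (∑ i, W θ' i ω j) θ' := fun j => by
        rw [hW]
        have := ((Real.hasDerivAt_sin θ').mul_const ((∑ i, x i ω) j)).add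
          ((Real.hasDerivAt_cos θ').mul_const ((∑ i, y i ω) j))
        exact this.congr_deriv (by ring)
      have := (h₀ (smoothMax β (Z θ' ω))).comp θ' (hasDerivAt_smoothMax hβ.ne' hc)
      refine this.congr_deriv ?_
      rw [softAvg_sum, Finset.mul_sum]
  have bΦ : ∀ θ, |∫ ω, ∑ i, ψ θ i ω ∂P|
      ≤ 64 * Real.exp 12 * ((G₃ + G₂ * β + G₁ * β ^ 2) * K₃ + (G₂ + β * G₁) * K₂) := fun θ => by
    rw [integral_finsetSum _ fun i _ => iψ θ i]
    have hi : ∀ i, Integrable (fun ω => stepBound β G₁ G₂ G₃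
          (fun j => ∫ ω, (|x i ω j| ^ 3 + |y i ω j| ^ 3) ∂P)
          (fun j k => |∫ ω, x i ω j * x i ω k ∂P - ∫ ω, y i ω j * y i ω k ∂P|) (Z θ ω)) P :=
      fun i => integrable_stepBound_comp hβ n₁ n₂ n₃
        (fun j => integral_nonneg fun ω => by positivity) (fun j k => abs_nonneg _) (mZ θ)
    have hstep : ∑ i, |∫ ω, ψ θ i ω ∂P| ≤ ∑ i, Real.exp 8 * ∫ ω, stepBound β G₁ G₂ G₃
          (fun j => ∫ ω, (|x i ω j| ^ 3 + |y i ω j| ^ 3) ∂P)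
          (fun j k => |∫ ω, x i ω j * x i ω k ∂P - ∫ ω, y i ω j * y i ω k ∂P|) (Z θ ω) ∂P :=
      Finset.sum_le_sum fun i _ => abs_integral_summand_le hβ hb h₁ h₂ b₁ b₂ b₃ hx hy hind bx bY
        ex ey exy (Real.abs_sin_le_one θ) (Real.abs_cos_le_one θ) i
    refine (Finset.abs_sum_le_sum_abs _ _).trans (hstep.trans ?_)
    rw [← Finset.mul_sum, ← integral_finsetSum _ fun i _ => hi i]
    simp only [stepBound_sum]
    have hle : ∫ ω, stepBound β G₁ G₂ G₃
        (fun j => ∑ i, ∫ ω, (|x i ω j| ^ 3 + |y i ω j| ^ 3) ∂P)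
        (fun j k => ∑ i, |∫ ω, x i ω j * x i ω k ∂P - ∫ ω, y i ω j * y i ω k ∂P|) (Z θ ω) ∂P
        ≤ ∫ _, (64 * Real.exp 4 * (G₃ + G₂ * β + G₁ * β ^ 2) * K₃ + (G₂ + β * G₁) * K₂
          + β * G₁ * K₂) ∂P := by
      refine integral_mono (integrable_stepBound_comp hβ n₁ n₂ n₃ (fun j => ?_) (fun j k => ?_)
        (mZ θ)) (integrable_const _) fun ω => stepBound_le_const hβ n₁ n₂ n₃ hK₃ hK₂ _
      · exact Finset.sum_nonneg fun i _ => integral_nonneg fun ω => by positivity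
      · exact Finset.sum_nonneg fun i _ => abs_nonneg _
    rw [integral_const, probReal_univ, one_smul] at hle
    have e12 : Real.exp 12 = Real.exp 8 * Real.exp 4 := by rw [← Real.exp_add]; norm_num
    have e4 : 1 ≤ Real.exp 4 := Real.one_le_exp (by norm_num)
    have hB : (G₂ + β * G₁) * K₂ + β * G₁ * K₂ ≤ 64 * Real.exp 4 * ((G₂ + β * G₁) * K₂) := by
      have k₁ : 0 ≤ β * G₁ * K₂ := by positivity
      have k₂ : 0 ≤ G₂ * K₂ := by positivity
      nlinarith
    calc _ ≤ Real.exp 8 * (64 * Real.exp 4 * (G₃ + G₂ * β + G₁ * β ^ 2) * K₃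
          + 64 * Real.exp 4 * ((G₂ + β * G₁) * K₂)) := by
          gcongr
          linarith
      _ = _ := by rw [e12]; ring
  -- the path runs from `∑ y` at `θ = 0` to `∑ x` at `θ = π / 2`
  have hfin := norm_image_sub_le_of_norm_deriv_le_segment' (a := 0) (b := Real.pi / 2)
    (fun θ _ => (dΦ θ).hasDerivWithinAt) (fun θ _ => bΦ θ) (Real.pi / 2)
    ⟨by positivity, le_rfl⟩
  simp only [Z, Real.sin_pi_div_two, Real.cos_pi_div_two, Real.sin_zero, Real.cos_zero, one_smul,
    zero_smul, add_zero, zero_add, Real.norm_eq_abs, sub_zero] at hfin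
  refine hfin.trans ?_
  have hpi : Real.pi / 2 ≤ 2 := by linarith [Real.pi_le_four]
  calc _ ≤ 64 * Real.exp 12 * ((G₃ + G₂ * β + G₁ * β ^ 2) * K₃ + (G₂ + β * G₁) * K₂) * 2 := by
        gcongr
    _ = _ := by ring

end interpolation

/-! ### Truncation of a single random variable -/

/-- Hard truncation of a real number at level `t`. -/
noncomputable def hardTrunc (t a : ℝ) : ℝ := if |a| ≤ t then a else 0

lemma measurable_hardTrunc (t : ℝ) : Measurable (hardTrunc t) :=
  Measurable.ite (measurableSet_le measurable_id.abs measurable_const) measurable_id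
    measurable_const

lemma abs_hardTrunc_le {t : ℝ} (ht : 0 ≤ t) (a : ℝ) : |hardTrunc t a| ≤ t := by
  unfold hardTrunc; split_ifs with h
  · exact h
  · simpa using ht

lemma abs_hardTrunc_le_abs (t a : ℝ) : |hardTrunc t a| ≤ |a| := by
  unfold hardTrunc; split_ifs with h
  · exact le_rfl
  · simp

section scalar

variable {Ω : Type*} [MeasurableSpace Ω] {P : Measure Ω}

lemma abs_integral_mul_le_sqrt {f h : Ω → ℝ} (hf : MemLp f 2 P) (hh : MemLp h 2 P) :
    |∫ ω, f ω * h ω ∂P| ≤ √(∫ ω, f ω ^ 2 ∂P) * √(∫ ω, h ω ^ 2 ∂P) := by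
  have h2 : ENNReal.ofReal 2 = 2 := by norm_num
  have := integral_mul_norm_le_Lp_mul_Lq (μ := P) (f := f) (g := h) Real.HolderConjugate.two_two
    (by rwa [h2]) (by rwa [h2])
  simp only [Real.norm_eq_abs, Real.rpow_two, sq_abs] at this
  rw [Real.sqrt_eq_rpow, Real.sqrt_eq_rpow]
  refine le_trans ?_ this
  refine abs_integral_le_integral_abs.trans_eq ?_
  simp only [abs_mul]

lemma variance_le_second_moment [IsProbabilityMeasure P] {f : Ω → ℝ} (hf : MemLp f 2 P) :
    ∫ ω, (f ω - ∫ ω', f ω' ∂P) ^ 2 ∂P ≤ ∫ ω, f ω ^ 2 ∂P := by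
  have := variance_le_expectation_sq (μ := P) (X := f) hf.aestronglyMeasurable
  rw [variance_eq_integral hf.aestronglyMeasurable.aemeasurable] at this
  simpa using this

lemma memLp_hardTrunc {f : Ω → ℝ} (hm : Measurable f) {q : ENNReal} (hf : MemLp f q P) (t : ℝ) :
    MemLp (fun ω => hardTrunc t (f ω)) q P :=
  hf.mono ((measurable_hardTrunc t).comp hm).aestronglyMeasurable
    (ae_of_all _ fun ω => abs_hardTrunc_le_abs t (f ω))

/-- The second moment of the part of `f` cut off by truncation at level `t`. -/
noncomputable def tailMoment (P : Measure Ω) (f : Ω → ℝ) (t : ℝ) : ℝ :=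
  ∫ ω, {ω | t < |f ω|}.indicator (fun ω => f ω ^ 2) ω ∂P

lemma tailMoment_eq (f : Ω → ℝ) (t : ℝ) :
    tailMoment P f t = ∫ ω, (f ω - hardTrunc t (f ω)) ^ 2 ∂P := by
  refine integral_congr_ae (ae_of_all _ fun ω => ?_)
  by_cases h : t < |f ω|
  · simp [hardTrunc, h, not_le.2 h]
  · simp [hardTrunc, h, not_lt.1 h]

lemma integral_hardTrunc_eq [IsProbabilityMeasure P] {f : Ω → ℝ}
    (hm : Measurable f) (hf : MemLp f 2 P)
    (h0 : ∫ ω, f ω ∂P = 0) (t : ℝ) :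
    ∫ ω, hardTrunc t (f ω) ∂P = -∫ ω, (f ω - hardTrunc t (f ω)) ∂P := by
  rw [integral_sub (hf.integrable one_le_two)
    ((memLp_hardTrunc hm hf t).integrable one_le_two), h0]
  ring

/-- The mean of a centered variable after truncation is small, by the Cauchy–Schwarz inequality
on the event where the truncation acts. -/
lemma abs_integral_hardTrunc_le [IsProbabilityMeasure P] {f : Ω → ℝ}
    (hm : Measurable f) (hf : MemLp f 2 P)
    (h0 : ∫ ω, f ω ∂P = 0) (t : ℝ) :
    |∫ ω, hardTrunc t (f ω) ∂P| ≤ √(tailMoment P f t) * √(P.real {ω | t < |f ω|}) := by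
  have hs : MeasurableSet {ω | t < |f ω|} := measurableSet_lt measurable_const hm.abs
  have hi : MemLp ({ω | t < |f ω|}.indicator fun _ => (1 : ℝ)) 2 P :=
    (memLp_const 1).indicator hs
  have hd : MemLp (fun ω => f ω - hardTrunc t (f ω)) 2 P := hf.sub (memLp_hardTrunc hm hf t)
  have key := abs_integral_mul_le_sqrt hd hi
  have e₁ : ∀ ω, (f ω - hardTrunc t (f ω)) * {ω | t < |f ω|}.indicator (fun _ => (1 : ℝ)) ω
      = f ω - hardTrunc t (f ω) := fun ω => by
    by_cases h : t < |f ω|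
    · simp [h]
    · simp [hardTrunc, not_lt.1 h]
  have e₂ : ∀ ω, {ω | t < |f ω|}.indicator (fun _ => (1 : ℝ)) ω ^ 2
      = {ω | t < |f ω|}.indicator 1 ω := fun ω => by
    by_cases h : t < |f ω| <;> simp [h]
  simp only [e₁, e₂, integral_indicator_one hs] at key
  rwa [integral_hardTrunc_eq hm hf h0, abs_neg, tailMoment_eq]

/-- Truncation at level `t` followed by centering. -/
noncomputable def truncCenter (P : Measure Ω) (f : Ω → ℝ) (t a : ℝ) : ℝ :=
  hardTrunc t a - ∫ ω, hardTrunc t (f ω) ∂P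

lemma measurable_truncCenter (f : Ω → ℝ) (t : ℝ) : Measurable (truncCenter P f t) :=
  (measurable_hardTrunc t).sub_const _

lemma abs_truncCenter_le [IsProbabilityMeasure P] (f : Ω → ℝ) {t : ℝ} (ht : 0 ≤ t) (a : ℝ) :
    |truncCenter P f t a| ≤ 2 * t := by
  have h1 := abs_hardTrunc_le ht a
  have h2 : |∫ ω, hardTrunc t (f ω) ∂P| ≤ t := by
    have := norm_integral_le_of_norm_le_const (μ := P) (f := fun ω => hardTrunc t (f ω)) (C := t)
      (ae_of_all _ fun ω => abs_hardTrunc_le ht (f ω))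
    simpa using this
  calc _ ≤ |hardTrunc t a| + |∫ ω, hardTrunc t (f ω) ∂P| := abs_sub _ _
    _ ≤ _ := by linarith

lemma memLp_truncCenter [IsProbabilityMeasure P] {f : Ω → ℝ}
    (hm : Measurable f) {q : ENNReal} (hf : MemLp f q P) (t : ℝ) :
    MemLp (fun ω => truncCenter P f t (f ω)) q P :=
  (memLp_hardTrunc hm hf t).sub (memLp_const _)

lemma integral_truncCenter [IsProbabilityMeasure P] {f : Ω → ℝ}
    (hm : Measurable f) (hf : Integrable f P) (t : ℝ) :
    ∫ ω, truncCenter P f t (f ω) ∂P = 0 := by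
  have h1 := (memLp_one_iff_integrable.1 (memLp_hardTrunc hm (memLp_one_iff_integrable.2 hf) t))
  unfold truncCenter
  rw [integral_sub h1 (integrable_const _)]
  simp

lemma integral_truncCenter_sq_le [IsProbabilityMeasure P] {f : Ω → ℝ}
    (hm : Measurable f) (hf : MemLp f 2 P) (t : ℝ) :
    ∫ ω, truncCenter P f t (f ω) ^ 2 ∂P ≤ ∫ ω, f ω ^ 2 ∂P := by
  refine (variance_le_second_moment (memLp_hardTrunc hm hf t)).trans ?_
  refine integral_mono (memLp_hardTrunc hm hf t).integrable_sq hf.integrable_sq fun ω => ?_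
  exact sq_le_sq.2 (abs_hardTrunc_le_abs t (f ω))

lemma integral_sub_truncCenter_sq_le [IsProbabilityMeasure P] {f : Ω → ℝ}
    (hm : Measurable f) (hf : MemLp f 2 P)
    (h0 : ∫ ω, f ω ∂P = 0) (t : ℝ) :
    ∫ ω, (f ω - truncCenter P f t (f ω)) ^ 2 ∂P ≤ tailMoment P f t := by
  rw [tailMoment_eq]
  have hd : MemLp (fun ω => f ω - hardTrunc t (f ω)) 2 P := hf.sub (memLp_hardTrunc hm hf t)
  refine le_trans (le_of_eq (integral_congr_ae (ae_of_all _ fun ω => ?_)))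
    (variance_le_second_moment hd)
  simp only [truncCenter, integral_hardTrunc_eq hm hf h0]
  ring

lemma integral_abs_truncCenter_pow_three_le [IsProbabilityMeasure P] {f : Ω → ℝ}
    (hm : Measurable f) (hf : MemLp f 3 P)
    (t : ℝ) : ∫ ω, |truncCenter P f t (f ω)| ^ 3 ∂P ≤ 8 * ∫ ω, |f ω| ^ 3 ∂P := by
  have i3 : ∀ h : Ω → ℝ, MemLp h 3 P → Integrable (fun ω => |h ω| ^ 3) P := fun h hh => by
    have := hh.integrable_norm_pow (p := 3) (by norm_num)
    simpa using this
  have hT := memLp_hardTrunc hm hf t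
  set e := ∫ ω, hardTrunc t (f ω) ∂P with he
  have i1 : Integrable (fun ω => |hardTrunc t (f ω)|) P := (hT.integrable (by norm_num)).abs
  -- Jensen's inequality, through the tangent line of the cube
  have hJ : |e| ^ 3 ≤ ∫ ω, |f ω| ^ 3 ∂P := by
    have hle : |e| ≤ ∫ ω, |hardTrunc t (f ω)| ∂P := abs_integral_le_integral_abs
    have hmono : ∫ ω, (3 * |e| ^ 2 * |hardTrunc t (f ω)| - 2 * |e| ^ 3) ∂P
        ≤ ∫ ω, |f ω| ^ 3 ∂P := by
      refine integral_mono ((i1.const_mul _).sub (integrable_const _)) (i3 _ hf) fun ω => ?_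
      have h1 : |hardTrunc t (f ω)| ^ 3 ≤ |f ω| ^ 3 := by
        exact pow_le_pow_left₀ (abs_nonneg _) (abs_hardTrunc_le_abs t (f ω)) 3
      refine le_trans ?_ h1
      have ha := abs_nonneg (hardTrunc t (f ω))
      have hb := abs_nonneg e
      nlinarith [mul_nonneg (add_nonneg ha (add_nonneg hb hb))
        (sq_nonneg (|hardTrunc t (f ω)| - |e|))]
    rw [integral_sub (i1.const_mul _) (integrable_const _), integral_const_mul, integral_const,
      probReal_univ, one_smul] at hmono
    nlinarith [mul_le_mul_of_nonneg_left hle (by positivity : 0 ≤ 3 * |e| ^ 2)]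
  have hmono : ∫ ω, |truncCenter P f t (f ω)| ^ 3 ∂P ≤ ∫ ω, (4 * |f ω| ^ 3 + 4 * |e| ^ 3) ∂P := by
    refine integral_mono (i3 _ (memLp_truncCenter hm hf t))
      (((i3 _ hf).const_mul 4).add (integrable_const _)) fun ω => ?_
    have ha := abs_nonneg (f ω)
    have hb := abs_nonneg e
    have h1 : |truncCenter P f t (f ω)| ≤ |f ω| + |e| :=
      (abs_sub _ _).trans (add_le_add_left (abs_hardTrunc_le_abs t (f ω)) _)
    have h2 : |truncCenter P f t (f ω)| ^ 3 ≤ (|f ω| + |e|) ^ 3 := by gcongr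
    refine h2.trans ?_
    show (|f ω| + |e|) ^ 3 ≤ 4 * |f ω| ^ 3 + 4 * |e| ^ 3
    nlinarith [mul_nonneg (add_nonneg ha hb) (sq_nonneg (|f ω| - |e|))]
  rw [integral_add ((i3 _ hf).const_mul 4) (integrable_const _), integral_const_mul,
    integral_const, probReal_univ, one_smul] at hmono
  linarith

lemma abs_integral_mul_sub_truncCenter_le [IsProbabilityMeasure P] {f h : Ω → ℝ}
    (mf : Measurable f) (mh : Measurable h)
    (hf : MemLp f 2 P) (hh : MemLp h 2 P) (f0 : ∫ ω, f ω ∂P = 0) (h0 : ∫ ω, h ω ∂P = 0)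
    (s t : ℝ) :
    |∫ ω, f ω * h ω ∂P - ∫ ω, truncCenter P f s (f ω) * truncCenter P h t (h ω) ∂P|
      ≤ √(tailMoment P f s) * √(∫ ω, h ω ^ 2 ∂P)
        + √(∫ ω, f ω ^ 2 ∂P) * √(tailMoment P h t) := by
  have Tf := memLp_truncCenter mf hf s
  have Th := memLp_truncCenter mh hh t
  have df : MemLp (fun ω => f ω - truncCenter P f s (f ω)) 2 P := hf.sub Tf
  have dh : MemLp (fun ω => h ω - truncCenter P h t (h ω)) 2 P := hh.sub Th
  have i₁ : Integrable (fun ω => f ω * h ω) P := hf.integrable_mul hh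
  have i₂ : Integrable (fun ω => truncCenter P f s (f ω) * truncCenter P h t (h ω)) P :=
    Tf.integrable_mul Th
  have i₃ : Integrable (fun ω => (f ω - truncCenter P f s (f ω)) * h ω) P := df.integrable_mul hh
  have i₄ : Integrable (fun ω => truncCenter P f s (f ω) * (h ω - truncCenter P h t (h ω))) P :=
    Tf.integrable_mul dh
  have e : ∫ ω, f ω * h ω ∂P - ∫ ω, truncCenter P f s (f ω) * truncCenter P h t (h ω) ∂P
      = ∫ ω, (f ω - truncCenter P f s (f ω)) * h ω ∂P
        + ∫ ω, truncCenter P f s (f ω) * (h ω - truncCenter P h t (h ω)) ∂P := by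
    rw [← integral_sub i₁ i₂, ← integral_add i₃ i₄]
    exact integral_congr_ae (ae_of_all _ fun ω => by ring)
  rw [e]
  refine (abs_add_le _ _).trans (add_le_add ?_ ?_)
  · exact (abs_integral_mul_le_sqrt df hh).trans (mul_le_mul_of_nonneg_right
      (Real.sqrt_le_sqrt (integral_sub_truncCenter_sq_le mf hf f0 s)) (Real.sqrt_nonneg _))
  · exact (abs_integral_mul_le_sqrt Tf dh).trans (mul_le_mul
      (Real.sqrt_le_sqrt (integral_truncCenter_sq_le mf hf s))
      (Real.sqrt_le_sqrt (integral_sub_truncCenter_sq_le mh hh h0 t)) (Real.sqrt_nonneg _)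
      (Real.sqrt_nonneg _))

end scalar

/-! ### The smooth maximum and the maximum -/

section maxima

variable {p : ℕ}

lemma le_maxCoord (z : Fin p → ℝ) (j : Fin p) : z j ≤ maxCoord z :=
  le_ciSup (Set.finite_range z).bddAbove j

lemma maxCoord_le_smoothMax [NeZero p] {β : ℝ} (hβ : 0 < β) (z : Fin p → ℝ) :
    maxCoord z ≤ smoothMax β z := by
  refine ciSup_le fun j => ?_
  have h : Real.exp (β * z j) ≤ ∑ k, Real.exp (β * z k) :=
    Finset.single_le_sum (f := fun k => Real.exp (β * z k)) (fun _ _ => (Real.exp_pos _).le)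
      (Finset.mem_univ j)
  have h2 := Real.log_le_log (Real.exp_pos _) h
  rw [Real.log_exp] at h2
  rw [smoothMax, inv_mul_eq_div, le_div_iff₀ hβ]
  linarith

lemma smoothMax_le [NeZero p] {β : ℝ} (hβ : 0 < β) (z : Fin p → ℝ) :
    smoothMax β z ≤ maxCoord z + β⁻¹ * Real.log p := by
  have h : ∑ k, Real.exp (β * z k) ≤ p * Real.exp (β * maxCoord z) := by
    calc _ ≤ ∑ _k : Fin p, Real.exp (β * maxCoord z) := by
          gcongr with k
          exact le_maxCoord z k
      _ = _ := by simp
  have hp : (0 : ℝ) < p := Nat.cast_pos.2 (NeZero.pos p)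
  have h2 := Real.log_le_log (expSum_pos β z) h
  rw [Real.log_mul hp.ne' (Real.exp_pos _).ne', Real.log_exp] at h2
  calc smoothMax β z ≤ β⁻¹ * (Real.log p + β * maxCoord z) :=
        mul_le_mul_of_nonneg_left h2 (by positivity)
    _ = _ := by field_simp; ring

lemma abs_smoothMax_sub_le [NeZero p] {β : ℝ} (hβ : 0 < β) {z z' : Fin p → ℝ} {d : ℝ}
    (h : ∀ j, |z j - z' j| ≤ d) : |smoothMax β z - smoothMax β z'| ≤ d := by
  have key : ∀ w w' : Fin p → ℝ, (∀ j, |w j - w' j| ≤ d) → smoothMax β w ≤ smoothMax β w' + d := by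
    intro w w' hw
    have h1 : ∑ k, Real.exp (β * w k) ≤ Real.exp (β * d) * ∑ k, Real.exp (β * w' k) := by
      rw [Finset.mul_sum]
      refine Finset.sum_le_sum fun k _ => ?_
      rw [← Real.exp_add, ← mul_add]
      refine Real.exp_le_exp.2 (mul_le_mul_of_nonneg_left ?_ hβ.le)
      linarith [(abs_le.1 (hw k)).2]
    have h2 := Real.log_le_log (expSum_pos β w) h1
    have hS : ∑ k, Real.exp (β * w' k) ≠ 0 := (expSum_pos β w').ne'
    rw [Real.log_mul (Real.exp_pos _).ne' hS, Real.log_exp] at h2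
    calc smoothMax β w ≤ β⁻¹ * (β * d + Real.log (∑ k, Real.exp (β * w' k))) :=
          mul_le_mul_of_nonneg_left h2 (by positivity)
      _ = _ := by rw [smoothMax]; field_simp; ring
  have h1 := key z z' h
  have h2 := key z' z fun j => by rw [abs_sub_comm]; exact h j
  exact abs_le.2 ⟨by linarith, by linarith⟩

lemma measurable_maxCoord : Measurable (maxCoord : (Fin p → ℝ) → ℝ) :=
  Measurable.iSup fun j => measurable_pi_apply j

end maxima

/-! ### Moments, thresholds and truncated sums -/

section moments

variable {n p : ℕ} {Ω : Type*} [MeasurableSpace Ω] {P : Measure Ω}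

lemma avgE_nonneg {f : Fin n → Ω → ℝ} (hf : ∀ i ω, 0 ≤ f i ω) : 0 ≤ avgE P f :=
  mul_nonneg (by positivity) (Finset.sum_nonneg fun i _ => integral_nonneg (hf i))

lemma mul_avgE (hn : n ≠ 0) (f : Fin n → Ω → ℝ) : n * avgE P f = ∑ i, ∫ ω, f i ω ∂P := by
  rw [avgE, mul_inv_cancel_left₀ (Nat.cast_ne_zero.2 hn)]

lemma momentBound_nonneg (x : Fin n → Ω → Fin p → ℝ) (k : ℕ) : 0 ≤ momentBound P x k :=
  Real.iSup_nonneg fun j => Real.rpow_nonneg (avgE_nonneg fun i ω => by positivity) _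

lemma rpow_avgE_le_momentBound (x : Fin n → Ω → Fin p → ℝ) (k : ℕ) (j : Fin p) :
    (avgE P fun i ω => |x i ω j| ^ k) ^ (1 / (k : ℝ)) ≤ momentBound P x k :=
  le_ciSup (f := fun j => (avgE P fun i ω => |x i ω j| ^ k) ^ (1 / (k : ℝ)))
    (Set.finite_range _).bddAbove j

lemma avgE_le_momentBound_pow (x : Fin n → Ω → Fin p → ℝ) {k : ℕ} (hk : k ≠ 0) (j : Fin p) :
    avgE P (fun i ω => |x i ω j| ^ k) ≤ momentBound P x k ^ k := by
  have h0 : 0 ≤ avgE P fun i ω => |x i ω j| ^ k := avgE_nonneg fun i ω => by positivity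
  have h := pow_le_pow_left₀ (Real.rpow_nonneg h0 _) (rpow_avgE_le_momentBound x k j) k
  rwa [← Real.rpow_natCast, ← Real.rpow_mul h0, one_div_mul_cancel (Nat.cast_ne_zero.2 hk),
    Real.rpow_one] at h

lemma sigma_nonneg (x : Fin n → Ω → Fin p → ℝ) (j : Fin p) : 0 ≤ sigma P x j :=
  Real.sqrt_nonneg _

lemma sigma_le_momentBound (x : Fin n → Ω → Fin p → ℝ) (j : Fin p) :
    sigma P x j ≤ momentBound P x 2 := by
  have := rpow_avgE_le_momentBound (P := P) x 2 j
  simp only [sq_abs] at this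
  rwa [sigma, Real.sqrt_eq_rpow]

lemma sum_integral_sq (hn : n ≠ 0) (x : Fin n → Ω → Fin p → ℝ) (j : Fin p) :
    ∑ i, ∫ ω, x i ω j ^ 2 ∂P = n * sigma P x j ^ 2 := by
  rw [sigma, Real.sq_sqrt (avgE_nonneg fun i ω => sq_nonneg _),
    mul_avgE hn fun i ω => x i ω j ^ 2]

lemma truncImpact_nonneg (x : Fin n → Ω → Fin p → ℝ) (u : ℝ) : 0 ≤ truncImpact P x u :=
  Real.sInf_nonneg fun _ h => h.1

/-- The infimum defining the truncation impact is attained. -/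
lemma sum_tailMoment_le (hn : n ≠ 0) {x : Fin n → Ω → Fin p → ℝ}
    (hm : ∀ i, Measurable (x i)) (h2 : ∀ i j, MemLp (fun ω => x i ω j) 2 P) {u φ : ℝ}
    (hφ : truncImpact P x u ≤ φ) (j : Fin p) :
    ∑ i, tailMoment P (fun ω => x i ω j) (u * sigma P x j) ≤ φ ^ 2 * (n * sigma P x j ^ 2) := by
  set S := {φ : ℝ | 0 ≤ φ ∧ ∀ j,
    avgE P (fun i => {ω | u * sigma P x j < |x i ω j|}.indicator fun ω => (x i ω j) ^ 2)
      ≤ φ ^ 2 * avgE P fun i ω => (x i ω j) ^ 2} with hS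
  have hne : S.Nonempty := by
    refine ⟨1, zero_le_one, fun k => ?_⟩
    rw [one_pow, one_mul]
    refine mul_le_mul_of_nonneg_left (Finset.sum_le_sum fun i _ => ?_) (by positivity)
    refine integral_mono ((h2 i k).integrable_sq.indicator ?_) (h2 i k).integrable_sq fun ω => ?_
    · exact measurableSet_lt measurable_const ((measurable_pi_apply k).comp (hm i)).abs
    · exact Set.indicator_le_self' (fun _ _ => sq_nonneg _) ω
  have hcl : IsClosed S := by
    refine isClosed_Ici.inter (?_ : IsClosed {φ : ℝ | ∀ j, _})
    simp only [Set.ofPred_forall]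
    exact isClosed_iInter fun k => isClosed_le continuous_const (by fun_prop)
  have hmem : truncImpact P x u ∈ S := hcl.csInf_mem hne ⟨0, fun _ h => h.1⟩
  have h := hmem.2 j
  have h' := mul_le_mul_of_nonneg_left h (Nat.cast_nonneg (α := ℝ) n)
  rw [mul_avgE hn] at h'
  refine h'.trans ?_
  rw [mul_left_comm, mul_avgE hn fun i ω => x i ω j ^ 2, sum_integral_sq hn]
  have := pow_le_pow_left₀ hmem.1 hφ 2
  gcongr

/-- The infimum defining the quantile is attained, by continuity of the measure along decreasing
thresholds; there are admissible thresholds because a coordinate with `sigma = 0` vanishes almost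
surely. -/
lemma one_sub_le_prob [IsProbabilityMeasure P] (hn : n ≠ 0) {x : Fin n → Ω → Fin p → ℝ}
    (hm : ∀ i, Measurable (x i)) (h2 : ∀ i j, MemLp (fun ω => x i ω j) 2 P) {u γ : ℝ}
    (hγ : 0 < γ) (hu : upperQuantile P x γ ≤ u) :
    1 - γ ≤ P.real {ω | ∀ i j, |x i ω j| ≤ u * sigma P x j} := by
  set A : ℝ → Set Ω := fun v => {ω | ∀ i j, |x i ω j| ≤ v * sigma P x j} with hA
  have mx : ∀ i j, Measurable fun ω => |x i ω j| := fun i j =>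
    ((measurable_pi_apply j).comp (hm i)).abs
  have mA : ∀ v, MeasurableSet (A v) := fun v => by
    simp only [hA, Set.ofPred_forall]
    exact MeasurableSet.iInter fun i => MeasurableSet.iInter fun j =>
      measurableSet_le (mx i j) measurable_const
  have hmono : Monotone A := fun v v' h ω hω i j =>
    (hω i j).trans (mul_le_mul_of_nonneg_right h (sigma_nonneg x j))
  have hzero : ∀ i j, sigma P x j = 0 → ∀ᵐ ω ∂P, x i ω j = 0 := fun i j h0 => by
    have hs := sum_integral_sq (P := P) hn x j
    rw [h0, zero_pow two_ne_zero, mul_zero, Finset.sum_eq_zero_iff_of_nonneg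
      fun i _ => integral_nonneg fun ω => sq_nonneg _] at hs
    have := (integral_eq_zero_iff_of_nonneg (fun ω => sq_nonneg _) (h2 i j).integrable_sq).1
      (hs i (Finset.mem_univ i))
    filter_upwards [this] with ω hω
    simpa using hω
  have hfull : P (⋃ k : ℕ, A (k : ℝ)) = 1 := by
    refine (mem_ae_iff_prob_eq_one (MeasurableSet.iUnion fun k : ℕ => mA k)).1 ?_
    have hae : ∀ᵐ ω ∂P, ∀ i j, sigma P x j = 0 → x i ω j = 0 := by
      refine ae_all_iff.2 fun i => ae_all_iff.2 fun j => ?_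
      by_cases h0 : sigma P x j = 0
      · filter_upwards [hzero i j h0] with ω hω _ using hω
      · exact ae_of_all _ fun ω h => absurd h h0
    filter_upwards [hae] with ω hω
    obtain ⟨k, hk⟩ := exists_nat_ge (∑ i, ∑ j, |x i ω j| / sigma P x j)
    refine Set.mem_iUnion.2 ⟨k, fun i j => ?_⟩
    rcases (sigma_nonneg (P := P) x j).eq_or_lt with h0 | h0
    · rw [hω i j h0.symm, abs_zero, ← h0, mul_zero]
    · have hnn : ∀ i j, 0 ≤ |x i ω j| / sigma P x j := fun i j =>
        div_nonneg (abs_nonneg _) (sigma_nonneg x j)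
      rw [← div_le_iff₀ h0]
      exact ((Finset.single_le_sum (fun j _ => hnn i j) (Finset.mem_univ j)).trans
        (Finset.single_le_sum (f := fun i => ∑ j, |x i ω j| / sigma P x j)
          (fun i _ => Finset.sum_nonneg fun j _ => hnn i j) (Finset.mem_univ i))).trans hk
  have hne : ∃ v, 0 ≤ v ∧ 1 - γ ≤ P.real (A v) := by
    have ht := tendsto_measure_iUnion_atTop (μ := P) (s := fun k : ℕ => A k)
      (hmono.comp Nat.mono_cast)
    rw [hfull] at ht
    have ht' := (ENNReal.tendsto_toReal ENNReal.one_ne_top).comp ht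
    obtain ⟨k, hk⟩ := (ht'.eventually_const_le (u := 1 - γ) (by simpa using hγ)).exists
    exact ⟨k, by positivity, hk⟩
  have hall : ∀ k : ℕ, 1 - γ ≤ P.real (A (u + 1 / ((k : ℝ) + 1))) := fun k => by
    have hlt : sInf {v : ℝ | 0 ≤ v ∧ 1 - γ ≤ P.real (A v)} < u + 1 / ((k : ℝ) + 1) :=
      lt_of_le_of_lt hu (by linarith [Nat.one_div_pos_of_nat (α := ℝ) (n := k)])
    obtain ⟨v, hv, hvu⟩ := exists_lt_of_csInf_lt hne hlt
    exact hv.2.trans (measureReal_mono (hmono hvu.le))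
  have hinter : ⋂ k : ℕ, A (u + 1 / ((k : ℝ) + 1)) = A u := by
    refine Set.Subset.antisymm (fun ω hω i j => ?_) (Set.subset_iInter fun k => hmono ?_)
    · have ht : Filter.Tendsto (fun k : ℕ => (u + 1 / ((k : ℝ) + 1)) * sigma P x j) Filter.atTop
          (nhds ((u + 0) * sigma P x j)) :=
        (tendsto_const_nhds.add tendsto_one_div_add_atTop_nhds_zero_nat).mul_const _
      rw [add_zero] at ht
      exact ge_of_tendsto' ht fun k => Set.mem_iInter.1 hω k i j
    · linarith [Nat.one_div_pos_of_nat (α := ℝ) (n := k)]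
  have hanti : Antitone fun k : ℕ => A (u + 1 / ((k : ℝ) + 1)) := fun k l hkl =>
    hmono (by gcongr)
  have ht := tendsto_measure_iInter_atTop (μ := P) (fun k => (mA _).nullMeasurableSet) hanti
    ⟨0, measure_ne_top _ _⟩
  rw [hinter] at ht
  exact ge_of_tendsto' ((ENNReal.tendsto_toReal (measure_ne_top _ _)).comp ht) hall

/-- If all coordinates stay below their thresholds with probability at least `1 / 2`, independence
bounds the expected number of exceedances in each coordinate. -/
lemma sum_prob_exceed_le_one [IsProbabilityMeasure P] {x : Fin n → Ω → Fin p → ℝ}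
    (hm : ∀ i, Measurable (x i)) (hind : iIndepFun x P) {t : Fin p → ℝ}
    (h : 1 / 2 ≤ P.real {ω | ∀ i j, |x i ω j| ≤ t j}) (j : Fin p) :
    ∑ i, P.real {ω | t j < |x i ω j|} ≤ 1 := by
  set B : Fin n → Set Ω := fun i => x i ⁻¹' {z | |z j| ≤ t j} with hB
  have mset : MeasurableSet {z : Fin p → ℝ | |z j| ≤ t j} :=
    measurableSet_le (measurable_pi_apply j).abs measurable_const
  have hprod : P (⋂ i ∈ Finset.univ, B i) = ∏ i, P (B i) :=
    hind.measure_inter_preimage_eq_mul Finset.univ (sets := fun _ => {z | |z j| ≤ t j})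
      fun i _ => mset
  have hcompl : ∀ i, P.real (B i) = 1 - P.real {ω | t j < |x i ω j|} := fun i => by
    rw [← probReal_compl_eq_one_sub]
    · congr 1
      ext ω
      simp [hB]
    · exact measurableSet_lt measurable_const ((measurable_pi_apply j).comp (hm i)).abs
  have h1 : 1 / 2 ≤ ∏ i, P.real (B i) := by
    calc _ ≤ P.real (⋂ i ∈ Finset.univ, B i) :=
          h.trans (measureReal_mono fun ω hω => by
            simp only [Set.mem_iInter]
            exact fun i _ => hω i j)
      _ = _ := by rw [Measure.real, hprod, ENNReal.toReal_prod]; rfl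
  have h2 : ∏ i, P.real (B i) ≤ Real.exp (-∑ i, P.real {ω | t j < |x i ω j|}) := by
    rw [← Finset.sum_neg_distrib, Real.exp_sum]
    refine Finset.prod_le_prod (fun i _ => measureReal_nonneg) fun i _ => ?_
    rw [hcompl]
    linarith [Real.add_one_le_exp (-P.real {ω | t j < |x i ω j|})]
  by_contra! hc
  have h3 : Real.exp (-∑ i, P.real {ω | t j < |x i ω j|}) ≤ Real.exp (-1) :=
    Real.exp_le_exp.2 (by linarith)
  have h4 : Real.exp (-1) < 1 / 2 := by
    rw [Real.exp_neg, one_div]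
    exact inv_strictAnti₀ (by norm_num) (by linarith [Real.exp_one_gt_d9])
  linarith

/-- The total displacement of the coordinate means caused by truncation. -/
lemma abs_sum_integral_hardTrunc_le [IsProbabilityMeasure P] {x : Fin n → Ω → Fin p → ℝ}
    (hm : ∀ i, Measurable (x i)) (h2 : ∀ i j, MemLp (fun ω => x i ω j) 2 P)
    (h0 : ∀ i j, ∫ ω, x i ω j ∂P = 0) {t σ : Fin p → ℝ} (hσ : ∀ j, 0 ≤ σ j) {φ : ℝ} (hφ0 : 0 ≤ φ)
    (hφ : ∀ j, ∑ i, tailMoment P (fun ω => x i ω j) (t j) ≤ φ ^ 2 * (n * σ j ^ 2))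
    (hp : ∀ j, ∑ i, P.real {ω | t j < |x i ω j|} ≤ 1) (j : Fin p) :
    |∑ i, ∫ ω, hardTrunc (t j) (x i ω j) ∂P| ≤ √n * (φ * σ j) := by
  have mx : ∀ i, Measurable fun ω => x i ω j := fun i => (measurable_pi_apply j).comp (hm i)
  calc _ ≤ ∑ i, |∫ ω, hardTrunc (t j) (x i ω j) ∂P| := Finset.abs_sum_le_sum_abs _ _
    _ ≤ ∑ i, √(tailMoment P (fun ω => x i ω j) (t j)) * √(P.real {ω | t j < |x i ω j|}) :=
        Finset.sum_le_sum fun i _ => abs_integral_hardTrunc_le (mx i) (h2 i j) (h0 i j) (t j)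
    _ ≤ √(∑ i, tailMoment P (fun ω => x i ω j) (t j)) * √(∑ i, P.real {ω | t j < |x i ω j|}) :=
        Real.sum_sqrt_mul_sqrt_le _
          (fun i => integral_nonneg fun ω => Set.indicator_nonneg (fun _ _ => sq_nonneg _) ω)
          (fun i => measureReal_nonneg)
    _ ≤ √(φ ^ 2 * (n * σ j ^ 2)) * √1 := by
        gcongr
        exacts [hφ j, hp j]
    _ = √n * (φ * σ j) := by
        rw [Real.sqrt_one, mul_one, show φ ^ 2 * (n * σ j ^ 2) = n * (φ * σ j) ^ 2 by ring,
          Real.sqrt_mul (Nat.cast_nonneg n), Real.sqrt_sq (mul_nonneg hφ0 (hσ j))]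

/-- The total change of the covariances caused by truncation. -/
lemma sum_abs_cov_sub_truncCenter_le [IsProbabilityMeasure P] {x : Fin n → Ω → Fin p → ℝ}
    (hm : ∀ i, Measurable (x i)) (h2 : ∀ i j, MemLp (fun ω => x i ω j) 2 P)
    (h0 : ∀ i j, ∫ ω, x i ω j ∂P = 0) {t σ : Fin p → ℝ} (hσ : ∀ j, 0 ≤ σ j) {φ : ℝ} (hφ0 : 0 ≤ φ)
    (hS : ∀ j, ∑ i, ∫ ω, x i ω j ^ 2 ∂P = n * σ j ^ 2)
    (hφ : ∀ j, ∑ i, tailMoment P (fun ω => x i ω j) (t j) ≤ φ ^ 2 * (n * σ j ^ 2)) (j k : Fin p) :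
    ∑ i, |∫ ω, x i ω j * x i ω k ∂P - ∫ ω, truncCenter P (fun ω => x i ω j) (t j) (x i ω j)
        * truncCenter P (fun ω => x i ω k) (t k) (x i ω k) ∂P| ≤ 2 * (n * (φ * (σ j * σ k))) := by
  have mx : ∀ i j, Measurable fun ω => x i ω j := fun i j => (measurable_pi_apply j).comp (hm i)
  have key : ∀ j k, ∑ i, √(tailMoment P (fun ω => x i ω j) (t j)) * √(∫ ω, x i ω k ^ 2 ∂P)
      ≤ n * (φ * (σ j * σ k)) := fun j k => by
    calc _ ≤ √(∑ i, tailMoment P (fun ω => x i ω j) (t j)) * √(∑ i, ∫ ω, x i ω k ^ 2 ∂P) :=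
          Real.sum_sqrt_mul_sqrt_le _
            (fun i => integral_nonneg fun ω => Set.indicator_nonneg (fun _ _ => sq_nonneg _) ω)
            (fun i => integral_nonneg fun ω => sq_nonneg _)
      _ ≤ √(φ ^ 2 * (n * σ j ^ 2)) * √(n * σ k ^ 2) := by
          rw [hS]
          gcongr
          exact hφ j
      _ = n * (φ * (σ j * σ k)) := by
          have hnn := Nat.cast_nonneg (α := ℝ) n
          rw [← Real.sqrt_mul (by positivity), show φ ^ 2 * (n * σ j ^ 2) * (n * σ k ^ 2)
            = ((n : ℝ) * (φ * (σ j * σ k))) ^ 2 by ring]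
          exact Real.sqrt_sq (mul_nonneg hnn (mul_nonneg hφ0 (mul_nonneg (hσ j) (hσ k))))
  calc _ ≤ ∑ i, (√(tailMoment P (fun ω => x i ω j) (t j)) * √(∫ ω, x i ω k ^ 2 ∂P)
        + √(tailMoment P (fun ω => x i ω k) (t k)) * √(∫ ω, x i ω j ^ 2 ∂P)) :=
        Finset.sum_le_sum fun i _ => (abs_integral_mul_sub_truncCenter_le (mx i j) (mx i k)
          (h2 i j) (h2 i k) (h0 i j) (h0 i k) (t j) (t k)).trans_eq (by ring)
    _ ≤ n * (φ * (σ j * σ k)) + n * (φ * (σ k * σ j)) := by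
        rw [Finset.sum_add_distrib]
        exact add_le_add (key j k) (key k j)
    _ = _ := by ring

/-- The cost of replacing the summands by truncated and centered ones. Where no summand exceeds its
threshold, the two sums differ by a deterministic vector. -/
lemma abs_integral_sub_truncCenter_le [IsProbabilityMeasure P] (hn : n ≠ 0)
    {x : Fin n → Ω → Fin p → ℝ}
    (hm : ∀ i, Measurable (x i)) {t : Fin p → ℝ} {d γ : ℝ}
    (hd : ∀ j, |∑ i, ∫ ω, hardTrunc (t j) (x i ω j) ∂P| ≤ √n * d)
    (hγ : 1 - γ ≤ P.real {ω | ∀ i j, |x i ω j| ≤ t j})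
    {f : (Fin p → ℝ) → ℝ} (mf : Measurable f) {G₀ G₁ : ℝ} (hG₁ : 0 ≤ G₁)
    (f0 : ∀ z, |f z| ≤ G₀)
    (f1 : ∀ z z' : Fin p → ℝ, ∀ d : ℝ, (∀ j, |z j - z' j| ≤ d) → |f z - f z'| ≤ G₁ * d)
    (hd0 : 0 ≤ d) :
    |∫ ω, f (rescaledSum x ω) ∂P - ∫ ω, f (rescaledSum
        (fun i ω j => truncCenter P (fun ω => x i ω j) (t j) (x i ω j)) ω) ∂P|
      ≤ 2 * G₀ * γ + G₁ * d := by
  set x' : Fin n → Ω → Fin p → ℝ :=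
    fun i ω j => truncCenter P (fun ω => x i ω j) (t j) (x i ω j) with hx'
  have mx : ∀ i j, Measurable fun ω => x i ω j := fun i j => (measurable_pi_apply j).comp (hm i)
  have mr : ∀ v : Fin n → Ω → Fin p → ℝ, (∀ i j, Measurable fun ω => v i ω j) →
      Measurable (rescaledSum v) := fun v hv => measurable_pi_lambda _ fun j =>
    (Finset.measurable_fun_sum _ fun i _ => hv i j).const_mul _
  have m1 := mf.comp (mr x mx)
  have m2 := mf.comp (mr x' fun i j => (measurable_truncCenter _ _).comp (mx i j))
  have i1 : Integrable (fun ω => f (rescaledSum x ω)) P :=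
    Integrable.of_bound m1.aestronglyMeasurable G₀ (ae_of_all _ fun ω => f0 _)
  have i2 : Integrable (fun ω => f (rescaledSum x' ω)) P :=
    Integrable.of_bound m2.aestronglyMeasurable G₀ (ae_of_all _ fun ω => f0 _)
  set E := {ω | ∀ i j, |x i ω j| ≤ t j} with hE
  have mE : MeasurableSet E := by
    simp only [hE, Set.ofPred_forall]
    exact MeasurableSet.iInter fun i => MeasurableSet.iInter fun j =>
      measurableSet_le (mx i j).abs measurable_const
  have hG₀ : 0 ≤ G₀ := (abs_nonneg _).trans (f0 0)
  have hpt : ∀ ω, |f (rescaledSum x ω) - f (rescaledSum x' ω)|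
      ≤ Eᶜ.indicator (fun _ => 2 * G₀) ω + G₁ * d := fun ω => by
    by_cases hω : ω ∈ E
    · rw [Set.indicator_of_notMem (by simpa using hω), zero_add]
      refine f1 _ _ _ fun j => ?_
      have e : rescaledSum x ω j - rescaledSum x' ω j
          = (√(n : ℝ))⁻¹ * ∑ i, ∫ ω, hardTrunc (t j) (x i ω j) ∂P := by
        rw [rescaledSum, rescaledSum, ← mul_sub, ← Finset.sum_sub_distrib]
        congr 1
        refine Finset.sum_congr rfl fun i _ => ?_
        simp only [hx', truncCenter, hardTrunc, if_pos (hω i j)]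
        ring
      have hsn : (0 : ℝ) < √n := Real.sqrt_pos.2 (Nat.cast_pos.2 (Nat.pos_of_ne_zero hn))
      rw [e, abs_mul, abs_of_pos (inv_pos.2 hsn), inv_mul_le_iff₀ hsn]
      exact hd j
    · rw [Set.indicator_of_mem (by simpa using hω)]
      have := abs_sub (f (rescaledSum x ω)) (f (rescaledSum x' ω))
      have h1 := f0 (rescaledSum x ω)
      have h2 := f0 (rescaledSum x' ω)
      have h3 := mul_nonneg hG₁ hd0
      linarith
  rw [← integral_sub i1 i2]
  refine abs_integral_le_integral_abs.trans ?_
  have ic : Integrable (Eᶜ.indicator fun _ => 2 * G₀) P := (integrable_const _).indicator mE.compl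
  refine (integral_mono (i1.sub i2).abs (ic.add (integrable_const (G₁ * d))) hpt).trans ?_
  have e2 : ∫ ω, (Eᶜ.indicator (fun _ => 2 * G₀) ω + G₁ * d) ∂P
      = P.real Eᶜ * (2 * G₀) + G₁ * d := by
    rw [integral_add ic (integrable_const _), integral_indicator mE.compl, setIntegral_const,
      integral_const, probReal_univ, one_smul, smul_eq_mul]
  simp only [Pi.add_apply]
  rw [e2, probReal_compl_eq_one_sub mE]
  nlinarith

end moments

/-! ### Realizing the two families independently of each other -/

section transfer

variable {n p : ℕ} {Ω : Type*} [MeasurableSpace Ω] {P : Measure Ω} [IsProbabilityMeasure P]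

lemma measurePreserving_eval_fst (i : Fin n) :
    MeasurePreserving (fun ω : Fin n → Ω × Ω => (ω i).1) (Measure.pi fun _ => P.prod P) P :=
  measurePreserving_fst.comp (measurePreserving_eval (fun _ : Fin n => P.prod P) i)

lemma measurePreserving_eval_snd (i : Fin n) :
    MeasurePreserving (fun ω : Fin n → Ω × Ω => (ω i).2) (Measure.pi fun _ => P.prod P) P :=
  measurePreserving_snd.comp (measurePreserving_eval (fun _ : Fin n => P.prod P) i)

lemma _root_.MeasureTheory.MeasurePreserving.integral_comp_of_measurable {A B : Type*}
    [MeasurableSpace A] [MeasurableSpace B] {μ : Measure A} {ν : Measure B} {T : A → B}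
    (hT : MeasurePreserving T μ ν) {f : B → ℝ} (hf : Measurable f) :
    ∫ a, f (T a) ∂μ = ∫ b, f b ∂ν := by
  rw [← hT.map_eq, integral_map hT.measurable.aemeasurable hf.aestronglyMeasurable]

/-- Evaluating each member of an independent family at its own measure-preserving coordinate does
not change the joint law. -/
lemma integral_pi_eq_of_iIndepFun {E : Type*} [MeasurableSpace E] {a : Fin n → Ω → E}
    (ha : ∀ i, Measurable (a i)) (hind : iIndepFun a P) {T : Fin n → Ω × Ω → Ω}
    (hT : ∀ i, MeasurePreserving (T i) (P.prod P) P) {f : (Fin n → E) → ℝ} (hf : Measurable f) :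
    ∫ ω : Fin n → Ω × Ω, f (fun i => a i (T i (ω i))) ∂(Measure.pi fun _ => P.prod P)
      = ∫ ω, f (fun i => a i ω) ∂P := by
  have haT : ∀ i, Measurable fun w => a i (T i w) := fun i => (ha i).comp (hT i).measurable
  have m : ∀ i, Measurable fun ω : Fin n → Ω × Ω => a i (T i (ω i)) := fun i =>
    (haT i).comp (measurable_pi_apply i)
  have hi : iIndepFun (fun i (ω : Fin n → Ω × Ω) => a i (T i (ω i)))
      (Measure.pi fun _ => P.prod P) :=
    iIndepFun_pi (X := fun i w => a i (T i w)) fun i => (haT i).aemeasurable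
  have e₁ := (iIndepFun_iff_map_fun_eq_pi_map fun i => (m i).aemeasurable).1 hi
  have e₂ := (iIndepFun_iff_map_fun_eq_pi_map fun i => (ha i).aemeasurable).1 hind
  have e₃ : ∀ i, (Measure.pi fun _ : Fin n => P.prod P).map (fun ω => a i (T i (ω i)))
      = P.map (a i) := fun i => by
    have hc := (hT i).comp (measurePreserving_eval (fun _ : Fin n => P.prod P) i)
    have hmm := Measure.map_map (μ := Measure.pi fun _ : Fin n => P.prod P) (ha i) hc.measurable
    rw [hc.map_eq] at hmm
    exact hmm.symm
  simp only [e₃] at e₁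
  rw [← e₂] at e₁
  rw [← integral_map (φ := fun (ω : Fin n → Ω × Ω) i => a i (T i (ω i)))
      (measurable_pi_lambda _ m).aemeasurable hf.aestronglyMeasurable, e₁,
    integral_map (measurable_pi_lambda _ ha).aemeasurable hf.aestronglyMeasurable]

/-- Comparison of two sums of bounded independent summands, whatever the joint law of the two
families: both sides only depend on the marginal laws, so the families may be realized
independently of each other on `(Ω × Ω)ⁿ`. -/
theorem abs_integral_smoothMax_sub_le_of_iIndepFun [NeZero p] {β b : ℝ} (hβ : 0 < β)
    (hb : β * b ≤ 1)
    {g g₁ g₂ g₃ : ℝ → ℝ} {G₀ G₁ G₂ G₃ : ℝ} (h₀ : ∀ t, HasDerivAt g (g₁ t) t)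
    (h₁ : ∀ t, HasDerivAt g₁ (g₂ t) t) (h₂ : ∀ t, HasDerivAt g₂ (g₃ t) t)
    (b₀ : ∀ t, |g t| ≤ G₀)
    (b₁ : ∀ t, |g₁ t| ≤ G₁) (b₂ : ∀ t, |g₂ t| ≤ G₂) (b₃ : ∀ t, |g₃ t| ≤ G₃)
    {x y : Fin n → Ω → Fin p → ℝ} (hx : ∀ i, Measurable (x i)) (hy : ∀ i, Measurable (y i))
    (ix : iIndepFun x P) (iy : iIndepFun y P)
    (bx : ∀ i ω j, |x i ω j| ≤ b) (bY : ∀ i ω j, |y i ω j| ≤ b)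
    (ex : ∀ i j, ∫ ω, x i ω j ∂P = 0) (ey : ∀ i j, ∫ ω, y i ω j ∂P = 0) {K₂ K₃ : ℝ}
    (hK₃ : ∀ j, ∑ i, (∫ ω, |x i ω j| ^ 3 ∂P + ∫ ω, |y i ω j| ^ 3 ∂P) ≤ K₃)
    (hK₂ : ∀ j k, ∑ i, |∫ ω, x i ω j * x i ω k ∂P - ∫ ω, y i ω j * y i ω k ∂P| ≤ K₂) :
    |∫ ω, g (smoothMax β (∑ i, x i ω)) ∂P - ∫ ω, g (smoothMax β (∑ i, y i ω)) ∂P|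
      ≤ 128 * Real.exp 12 * ((G₃ + G₂ * β + G₁ * β ^ 2) * K₃ + (G₂ + β * G₁) * K₂) := by
  have mx : ∀ i j, Measurable fun ω => x i ω j := fun i j => (measurable_pi_apply j).comp (hx i)
  have my : ∀ i j, Measurable fun ω => y i ω j := fun i j => (measurable_pi_apply j).comp (hy i)
  have cg : Continuous g := continuous_iff_continuousAt.2 fun t => (h₀ t).continuousAt
  have mf : Measurable fun v : Fin n → Fin p → ℝ => g (smoothMax β (∑ i, v i)) :=
    (cg.comp ((continuous_smoothMax β).comp (by fun_prop))).measurable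
  have e₁ := integral_pi_eq_of_iIndepFun hx ix (T := fun _ => Prod.fst)
    (fun _ => measurePreserving_fst) mf
  have e₂ := integral_pi_eq_of_iIndepFun hy iy (T := fun _ => Prod.snd)
    (fun _ => measurePreserving_snd) mf
  rw [← e₁, ← e₂]
  have tx : ∀ (i : Fin n) {f : Ω → ℝ}, Measurable f →
      ∫ ω : Fin n → Ω × Ω, f (ω i).1 ∂(Measure.pi fun _ => P.prod P) = ∫ ω, f ω ∂P := fun i f hf =>
    (measurePreserving_eval_fst i).integral_comp_of_measurable hf
  have ty : ∀ (i : Fin n) {f : Ω → ℝ}, Measurable f →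
      ∫ ω : Fin n → Ω × Ω, f (ω i).2 ∂(Measure.pi fun _ => P.prod P) = ∫ ω, f ω ∂P := fun i f hf =>
    (measurePreserving_eval_snd i).integral_comp_of_measurable hf
  have hcube : ∀ (μ : Measure (Fin n → Ω × Ω)) [IsFiniteMeasure μ] (f : (Fin n → Ω × Ω) → ℝ),
      Measurable f → (∀ ω, |f ω| ≤ b) → Integrable (fun ω => |f ω| ^ 3) μ := fun μ _ f mf' hf =>
    Integrable.of_bound (mf'.abs.pow_const 3).aestronglyMeasurable (b ^ 3) (ae_of_all _ fun ω => by
      rw [Real.norm_eq_abs, abs_of_nonneg (by positivity)]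
      exact pow_le_pow_left₀ (abs_nonneg _) (hf ω) 3)
  refine abs_integral_smoothMax_sub_le (x := fun i (ω : Fin n → Ω × Ω) => x i (ω i).1)
    (y := fun i (ω : Fin n → Ω × Ω) => y i (ω i).2) hβ hb h₀ h₁ h₂ b₀ b₁ b₂ b₃
    (fun i => (hx i).comp (measurePreserving_eval_fst (P := P) i).measurable)
    (fun i => (hy i).comp (measurePreserving_eval_snd (P := P) i).measurable)
    (iIndepFun_pi (X := fun i (w : Ω × Ω) => (x i w.1, y i w.2)) fun i =>
      (((hx i).comp measurable_fst).prodMk ((hy i).comp measurable_snd)).aemeasurable)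
    (fun i ω j => bx i _ j) (fun i ω j => bY i _ j)
    (fun i j => (tx i (mx i j)).trans (ex i j)) (fun i j => (ty i (my i j)).trans (ey i j))
    (fun i j k => ?_) (fun j => ?_) (fun j k => ?_)
  · have hT := measurePreserving_eval (fun _ : Fin n => P.prod P) i
    have := hT.integral_comp_of_measurable (f := fun w : Ω × Ω => x i w.1 j * y i w.2 k)
      (((mx i j).comp measurable_fst).mul ((my i k).comp measurable_snd))
    refine this.trans ?_
    rw [integral_prod_mul (fun ω => x i ω j) (fun ω => y i ω k), ex, zero_mul]
  · refine le_of_eq_of_le (Finset.sum_congr rfl fun i _ => ?_) (hK₃ j)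
    rw [integral_add
      (hcube _ (fun ω => x i (ω i).1 j)
        ((mx i j).comp (measurePreserving_eval_fst (P := P) i).measurable)
        fun ω => bx i _ j)
      (hcube _ (fun ω => y i (ω i).2 j)
        ((my i j).comp (measurePreserving_eval_snd (P := P) i).measurable)
        fun ω => bY i _ j)]
    exact congrArg₂ _ (tx i ((mx i j).abs.pow_const 3)) (ty i ((my i j).abs.pow_const 3))
  · refine le_of_eq_of_le (Finset.sum_congr rfl fun i _ => ?_) (hK₂ j k)
    rw [tx i (f := fun ω => x i ω j * x i ω k) ((mx i j).mul (mx i k)),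
      ty i (f := fun ω => y i ω j * y i ω k) ((my i j).mul (my i k))]

end transfer

/-! ### Third absolute moments of Gaussian variables -/

section gaussian

variable {Ω : Type*} [MeasurableSpace Ω] {P : Measure Ω}

/-- The third absolute moment of the standard normal law. -/
noncomputable def gaussThirdMoment : ℝ := ∫ t, |t| ^ 3 ∂(gaussianReal 0 1)

lemma gaussThirdMoment_nonneg : 0 ≤ gaussThirdMoment := integral_nonneg fun t => by positivity

lemma integral_abs_pow_three_of_hasGaussianLaw {f : Ω → ℝ} (hf : HasGaussianLaw f P)
    (h0 : ∫ ω, f ω ∂P = 0) :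
    ∫ ω, |f ω| ^ 3 ∂P = gaussThirdMoment * √(∫ ω, f ω ^ 2 ∂P) ^ 3 := by
  have := hf.isProbabilityMeasure
  have hv : Var[f; P] = ∫ ω, f ω ^ 2 ∂P := variance_of_integral_eq_zero hf.aemeasurable h0
  set s := √(∫ ω, f ω ^ 2 ∂P) with hs
  have hs0 : 0 ≤ s := Real.sqrt_nonneg _
  have hmap : P.map f = (gaussianReal 0 1).map (fun t => s * t) := by
    rw [hf.map_eq_gaussianReal, h0, hv, gaussianReal_map_const_mul, mul_zero]
    congr 1
    ext
    have hnn : 0 ≤ ∫ ω, f ω ^ 2 ∂P := integral_nonneg fun ω => sq_nonneg _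
    simp [hs, Real.sq_sqrt hnn, hnn]
  have mc : Measurable fun t : ℝ => |t| ^ 3 := by fun_prop
  have e₁ := integral_map (μ := P) hf.aemeasurable (f := fun t : ℝ => |t| ^ 3)
    mc.aestronglyMeasurable
  rw [← e₁, hmap, integral_map (by fun_prop) mc.aestronglyMeasurable, gaussThirdMoment,
    ← integral_mul_const]
  simp only [abs_mul, mul_pow, abs_of_nonneg hs0, mul_comm]

/-- Lyapunov's inequality between the second and third moments. -/
lemma sqrt_integral_sq_pow_three_le [IsProbabilityMeasure P] {f : Ω → ℝ} (hf : MemLp f 3 P) :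
    √(∫ ω, f ω ^ 2 ∂P) ^ 3 ≤ ∫ ω, |f ω| ^ 3 ∂P := by
  have hf2 : MemLp f 2 P := hf.mono_exponent (by norm_num)
  set s := √(∫ ω, f ω ^ 2 ∂P) with hs
  have hs0 : 0 ≤ s := Real.sqrt_nonneg _
  have hss : s ^ 2 = ∫ ω, f ω ^ 2 ∂P :=
    Real.sq_sqrt (integral_nonneg fun ω => sq_nonneg _)
  have i3 : Integrable (fun ω => |f ω| ^ 3) P := by
    have := hf.integrable_norm_pow (p := 3) (by norm_num)
    simpa using this
  -- the tangent line of `q ↦ q ^ (3 / 2)` at `s ^ 2`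
  have h : ∫ ω, (3 / 2 * s * f ω ^ 2 - s ^ 3 / 2) ∂P ≤ ∫ ω, |f ω| ^ 3 ∂P := by
    refine integral_mono ((hf2.integrable_sq.const_mul _).sub (integrable_const _)) i3 fun ω => ?_
    have ha := abs_nonneg (f ω)
    show 3 / 2 * s * f ω ^ 2 - s ^ 3 / 2 ≤ |f ω| ^ 3
    rw [← sq_abs (f ω)]
    nlinarith [mul_nonneg (add_nonneg ha (by positivity : 0 ≤ s / 2)) (sq_nonneg (|f ω| - s))]
  rw [integral_sub (hf2.integrable_sq.const_mul _) (integrable_const _), integral_const_mul,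
    integral_const, probReal_univ, one_smul, ← hss] at h
  linarith

end gaussian

/-! ### Test functions with bounded derivatives -/

section derivatives

lemma IsCb3.abs_le_supDeriv {g : ℝ → ℝ} (hg : IsCb3 g) {k : ℕ} (hk : k ≤ 3) (z : ℝ) :
    |iteratedDeriv k g z| ≤ supDeriv g k := by
  obtain ⟨B, hB⟩ := hg.2 k hk
  exact le_ciSup (f := fun z => |iteratedDeriv k g z|)
    ⟨B, by rintro _ ⟨z, rfl⟩; exact hB z⟩ z

lemma IsCb3.hasDerivAt {g : ℝ → ℝ} (hg : IsCb3 g) {k : ℕ} (hk : k < 3) (z : ℝ) :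
    HasDerivAt (iteratedDeriv k g) (iteratedDeriv (k + 1) g z) z := by
  rw [iteratedDeriv_succ]
  exact (hg.1.differentiable_iteratedDeriv k (by exact_mod_cast hk) z).hasDerivAt

lemma supDeriv_nonneg (g : ℝ → ℝ) (k : ℕ) : 0 ≤ supDeriv g k :=
  Real.iSup_nonneg fun _ => abs_nonneg _

lemma IsCb3.abs_sub_le {g : ℝ → ℝ} (hg : IsCb3 g) (a b : ℝ) :
    |g a - g b| ≤ supDeriv g 1 * |a - b| := by
  have h := convex_univ.norm_image_sub_le_of_norm_hasDerivWithin_le (f := g)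
    (f' := iteratedDeriv 1 g) (C := supDeriv g 1) (x := b) (y := a)
    (fun z _ => by
      have := hg.hasDerivAt (k := 0) (by norm_num) z
      rw [iteratedDeriv_zero] at this
      exact this.hasDerivWithinAt)
    (fun z _ => hg.abs_le_supDeriv (by norm_num) z) (Set.mem_univ _) (Set.mem_univ _)
  simpa using h

end derivatives

/-! ### Comparison after truncation -/

section comparison

variable {n p : ℕ}

lemma sum_smul_eq_rescaledSum {Ω : Type*} (x : Fin n → Ω → Fin p → ℝ) (ω : Ω) :
    ∑ i, (√(n : ℝ))⁻¹ • x i ω = rescaledSum x ω := by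
  ext j
  simp [rescaledSum, Finset.sum_apply, Finset.mul_sum]

variable {Ω : Type*} [MeasurableSpace Ω] {P : Measure Ω}

/-- The summands, truncated coordinatewise at the levels `t j` and centered again. -/
noncomputable def truncFamily (P : Measure Ω) (x : Fin n → Ω → Fin p → ℝ) (t : Fin p → ℝ)
    (i : Fin n) (ω : Ω) (j : Fin p) : ℝ :=
  truncCenter P (fun ω => x i ω j) (t j) (x i ω j)

lemma measurable_truncFamily_apply {x : Fin n → Ω → Fin p → ℝ} (t : Fin p → ℝ) (i : Fin n) :
    Measurable fun (z : Fin p → ℝ) j => truncCenter P (fun ω => x i ω j) (t j) (z j) :=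
  measurable_pi_lambda _ fun j => (measurable_truncCenter _ _).comp (measurable_pi_apply j)

/-- The comparison of the truncated sums. -/
lemma abs_integral_truncFamily_sub_le [IsProbabilityMeasure P] [NeZero p] (hn : n ≠ 0) {β b : ℝ}
    (hβ : 0 < β) (hb : β * ((√(n : ℝ))⁻¹ * (2 * b)) ≤ 1) {g : ℝ → ℝ} (hg : IsCb3 g)
    {x y : Fin n → Ω → Fin p → ℝ} (hx : ∀ i, Measurable (x i)) (hy : ∀ i, Measurable (y i))
    (ix : iIndepFun x P) (iy : iIndepFun y P)
    (x3 : ∀ i j, MemLp (fun ω => x i ω j) 3 P) (y3 : ∀ i j, MemLp (fun ω => y i ω j) 3 P)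
    (x0 : ∀ i j, ∫ ω, x i ω j ∂P = 0) (y0 : ∀ i j, ∫ ω, y i ω j ∂P = 0)
    (hcov : ∀ i j k, ∫ ω, y i ω j * y i ω k ∂P = ∫ ω, x i ω j * x i ω k ∂P)
    {t σ : Fin p → ℝ} (ht : ∀ j, 0 ≤ t j) (htb : ∀ j, t j ≤ b) (hσ : ∀ j, 0 ≤ σ j) {φ M L c : ℝ}
    (hφ0 : 0 ≤ φ) (hσM : ∀ j, σ j ≤ M)
    (Sx : ∀ j, ∑ i, ∫ ω, x i ω j ^ 2 ∂P = n * σ j ^ 2)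
    (Sy : ∀ j, ∑ i, ∫ ω, y i ω j ^ 2 ∂P = n * σ j ^ 2)
    (φx : ∀ j, ∑ i, tailMoment P (fun ω => x i ω j) (t j) ≤ φ ^ 2 * (n * σ j ^ 2))
    (φy : ∀ j, ∑ i, tailMoment P (fun ω => y i ω j) (t j) ≤ φ ^ 2 * (n * σ j ^ 2))
    (hc : 0 ≤ c) (hL : ∀ j, ∑ i, ∫ ω, |x i ω j| ^ 3 ∂P ≤ n * L)
    (hyx : ∀ i j, ∫ ω, |y i ω j| ^ 3 ∂P ≤ c * ∫ ω, |x i ω j| ^ 3 ∂P) :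
    |∫ ω, g (smoothMax β (rescaledSum (truncFamily P x t) ω)) ∂P
        - ∫ ω, g (smoothMax β (rescaledSum (truncFamily P y t) ω)) ∂P|
      ≤ 128 * Real.exp 12 * ((supDeriv g 3 + supDeriv g 2 * β + supDeriv g 1 * β ^ 2)
          * ((√(n : ℝ))⁻¹ * (8 * (1 + c) * L))
        + (supDeriv g 2 + β * supDeriv g 1) * (4 * (φ * M ^ 2))) := by
  have hnpos : (0 : ℝ) < n := Nat.cast_pos.2 (Nat.pos_of_ne_zero hn)
  set s := (√(n : ℝ))⁻¹ with hs
  have hs0 : 0 < s := inv_pos.2 (Real.sqrt_pos.2 hnpos)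
  have hsn : s ^ 2 * n = 1 := by
    rw [hs, inv_pow, Real.sq_sqrt hnpos.le, inv_mul_cancel₀ hnpos.ne']
  have mx : ∀ i j, Measurable fun ω => x i ω j := fun i j => (measurable_pi_apply j).comp (hx i)
  have my : ∀ i j, Measurable fun ω => y i ω j := fun i j => (measurable_pi_apply j).comp (hy i)
  have x2 : ∀ i j, MemLp (fun ω => x i ω j) 2 P := fun i j => (x3 i j).mono_exponent (by norm_num)
  have y2 : ∀ i j, MemLp (fun ω => y i ω j) 2 P := fun i j => (y3 i j).mono_exponent (by norm_num)
  have mT : ∀ (v : Fin n → Ω → Fin p → ℝ) i, Measurable fun z : Fin p → ℝ =>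
      s • fun j => truncCenter P (fun ω => v i ω j) (t j) (z j) := fun v i =>
    (measurable_truncFamily_apply t i).const_smul s
  have hbd : ∀ (v : Fin n → Ω → Fin p → ℝ) i ω j, |(s • truncFamily P v t i ω) j| ≤ s * (2 * b) :=
    fun v i ω j => by
      rw [Pi.smul_apply, smul_eq_mul, abs_mul, abs_of_pos hs0]
      gcongr
      exact (abs_truncCenter_le _ (ht j) _).trans (by linarith [htb j])
  have hmean : ∀ (v : Fin n → Ω → Fin p → ℝ), (∀ i j, Measurable fun ω => v i ω j) →
      (∀ i j, MemLp (fun ω => v i ω j) 2 P) →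
      ∀ i j, ∫ ω, (s • truncFamily P v t i ω) j ∂P = 0 := fun v mv v2 i j => by
    simp only [Pi.smul_apply, smul_eq_mul, truncFamily]
    rw [integral_const_mul, integral_truncCenter (mv i j) ((v2 i j).integrable one_le_two),
      mul_zero]
  have hthird : ∀ (v : Fin n → Ω → Fin p → ℝ), (∀ i j, Measurable fun ω => v i ω j) →
      (∀ i j, MemLp (fun ω => v i ω j) 3 P) → ∀ i j, ∫ ω, |(s • truncFamily P v t i ω) j| ^ 3 ∂P
        ≤ s ^ 3 * (8 * ∫ ω, |v i ω j| ^ 3 ∂P) := fun v mv v3 i j => by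
    simp only [Pi.smul_apply, smul_eq_mul, truncFamily, abs_mul, mul_pow, abs_of_pos hs0]
    rw [integral_const_mul]
    exact mul_le_mul_of_nonneg_left
      (integral_abs_truncCenter_pow_three_le (mv i j) (v3 i j) (t j)) (by positivity)
  have hprod : ∀ (v : Fin n → Ω → Fin p → ℝ) i j k,
      ∫ ω, (s • truncFamily P v t i ω) j * (s • truncFamily P v t i ω) k ∂P
        = s ^ 2 * ∫ ω, truncFamily P v t i ω j * truncFamily P v t i ω k ∂P := fun v i j k => by
    rw [← integral_const_mul]
    exact integral_congr_ae (ae_of_all _ fun ω => by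
      simp only [Pi.smul_apply, smul_eq_mul]; ring)
  have hM0 : 0 ≤ M := (hσ 0).trans (hσM 0)
  have key := abs_integral_smoothMax_sub_le_of_iIndepFun (P := P) hβ hb
    (g := g) (g₁ := iteratedDeriv 1 g) (g₂ := iteratedDeriv 2 g) (g₃ := iteratedDeriv 3 g)
    (G₀ := supDeriv g 0)
    (fun z => by
      have := hg.hasDerivAt (k := 0) (by norm_num) z
      rwa [iteratedDeriv_zero] at this)
    (fun z => hg.hasDerivAt (by norm_num) z) (fun z => hg.hasDerivAt (by norm_num) z)
    (fun z => by
      have := hg.abs_le_supDeriv (k := 0) (by norm_num) z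
      rwa [iteratedDeriv_zero] at this)
    (fun z => hg.abs_le_supDeriv (by norm_num) z) (fun z => hg.abs_le_supDeriv (by norm_num) z)
    (fun z => hg.abs_le_supDeriv (by norm_num) z)
    (x := fun i ω => s • truncFamily P x t i ω) (y := fun i ω => s • truncFamily P y t i ω)
    (fun i => (mT x i).comp (hx i)) (fun i => (mT y i).comp (hy i))
    (ix.comp _ (mT x)) (iy.comp _ (mT y)) (hbd x) (hbd y) (hmean x mx x2) (hmean y my y2)
    (K₂ := 4 * (φ * M ^ 2)) (K₃ := s * (8 * (1 + c) * L)) (fun j => ?_) (fun j k => ?_)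
  · simp only [hs, sum_smul_eq_rescaledSum] at key
    exact key
  · calc _ ≤ ∑ i, s ^ 3 * (8 * (1 + c)) * ∫ ω, |x i ω j| ^ 3 ∂P := by
          refine Finset.sum_le_sum fun i _ => ?_
          have h1 := hthird x mx x3 i j
          have h2 := hthird y my y3 i j
          have h3 := mul_le_mul_of_nonneg_left (hyx i j) (by positivity : 0 ≤ s ^ 3 * 8)
          linarith
      _ ≤ s ^ 3 * (8 * (1 + c)) * (n * L) := by
          rw [← Finset.mul_sum]
          exact mul_le_mul_of_nonneg_left (hL j) (by positivity)
      _ = s * (8 * (1 + c) * L) * (s ^ 2 * n) := by ring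
      _ = _ := by rw [hsn, mul_one]
  · simp only [hprod, ← mul_sub, abs_mul, ← Finset.mul_sum]
    rw [abs_of_pos (by positivity : 0 < s ^ 2)]
    have h1 := sum_abs_cov_sub_truncCenter_le hx x2 x0 hσ hφ0 Sx φx j k
    have h2 := sum_abs_cov_sub_truncCenter_le hy y2 y0 hσ hφ0 Sy φy j k
    have h3 : ∑ i, |∫ ω, truncFamily P x t i ω j * truncFamily P x t i ω k ∂P
        - ∫ ω, truncFamily P y t i ω j * truncFamily P y t i ω k ∂P|
        ≤ 2 * (n * (φ * (σ j * σ k))) + 2 * (n * (φ * (σ j * σ k))) := by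
      refine le_trans ?_ (add_le_add h1 h2)
      rw [← Finset.sum_add_distrib]
      refine Finset.sum_le_sum fun i _ => ?_
      have tri : ∀ q r r' : ℝ, |r - r'| ≤ |q - r| + |q - r'| := fun q r r' => by
        rw [abs_sub_comm q r]; exact abs_sub_le r q r'
      rw [hcov i j k]
      exact tri _ _ _
    have h4 : σ j * σ k ≤ M ^ 2 := by
      rw [sq]; exact mul_le_mul (hσM j) (hσM k) (hσ k) hM0
    calc _ ≤ s ^ 2 * (2 * (n * (φ * (σ j * σ k))) + 2 * (n * (φ * (σ j * σ k)))) := by gcongr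
      _ = 4 * (φ * (σ j * σ k)) * (s ^ 2 * n) := by ring
      _ ≤ 4 * (φ * M ^ 2) := by rw [hsn, mul_one]; gcongr

/-- The comparison for the smooth maximum. When `γ > 1 / 2` the term `G₀ γ` alone suffices;
otherwise both sums are truncated at the levels `u * sigma P x j`. -/
theorem abs_integral_smoothMax_rescaledSum_sub_le [IsProbabilityMeasure P] [NeZero p] (hn : n ≠ 0)
    {x y : Fin n → Ω → Fin p → ℝ} (hx : ∀ i, Measurable (x i)) (ix : iIndepFun x P)
    (x3 : ∀ i j, MemLp (fun ω => x i ω j) 3 P) (x0 : ∀ i j, ∫ ω, x i ω j ∂P = 0)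
    (hy : ∀ i, Measurable (y i)) (iy : iIndepFun y P) (yG : ∀ i, HasGaussianLaw (y i) P)
    (y0 : ∀ i j, ∫ ω, y i ω j ∂P = 0)
    (hcov : ∀ i j k, ∫ ω, y i ω j * y i ω k ∂P = ∫ ω, x i ω j * x i ω k ∂P)
    {β u γ : ℝ} (hβ : 0 < β) (hu : 0 < u) (hγ : 0 < γ)
    (hlog : 1 ≤ √(Real.log (p / γ)))
    (hub : 2 * √2 * u * momentBound P x 2 * β / √(n : ℝ) ≤ 1)
    (huγ : uGamma P x y γ ≤ u) {g : ℝ → ℝ} (hg : IsCb3 g) :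
    |∫ ω, g (smoothMax β (rescaledSum x ω)) ∂P - ∫ ω, g (smoothMax β (rescaledSum y ω)) ∂P|
      ≤ (1024 * Real.exp 12 * (1 + gaussThirdMoment) + 4) * errorBound P x y g β u γ := by
  have hc := gaussThirdMoment_nonneg
  have n0 := supDeriv_nonneg g 0
  have n1 := supDeriv_nonneg g 1
  have n2 := supDeriv_nonneg g 2
  have n3 := supDeriv_nonneg g 3
  have nM2 := momentBound_nonneg (P := P) x 2
  have nM3 := momentBound_nonneg (P := P) x 3
  have nφ : 0 ≤ phi P x y u := (truncImpact_nonneg x u).trans (le_max_left _ _)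
  have hsn : (0 : ℝ) < √n := Real.sqrt_pos.2 (Nat.cast_pos.2 (Nat.pos_of_ne_zero hn))
  have g0 : ∀ z, |g z| ≤ supDeriv g 0 := fun z => by
    have := hg.abs_le_supDeriv (k := 0) (by norm_num) z
    rwa [iteratedDeriv_zero] at this
  have hE1 : 0 ≤ (√(n : ℝ))⁻¹ * (supDeriv g 3 + supDeriv g 2 * β + supDeriv g 1 * β ^ 2)
      * momentBound P x 3 ^ 3 := by positivity
  have hE2 : 0 ≤ (supDeriv g 2 + β * supDeriv g 1) * momentBound P x 2 ^ 2 * phi P x y u := by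
    positivity
  have hE3 : supDeriv g 1 * momentBound P x 2 * phi P x y u
      ≤ supDeriv g 1 * momentBound P x 2 * phi P x y u * √(Real.log (p / γ)) :=
    le_mul_of_one_le_right (by positivity) hlog
  have hE3' : 0 ≤ supDeriv g 1 * momentBound P x 2 * phi P x y u := by positivity
  have hE4 : 0 ≤ supDeriv g 0 * γ := by positivity
  have hK : 0 ≤ 1024 * Real.exp 12 * (1 + gaussThirdMoment) := by positivity
  rcases lt_or_ge (1 / 2) γ with hγ2 | hγ2
  · have hbd : ∀ v : Fin n → Ω → Fin p → ℝ,
        |∫ ω, g (smoothMax β (rescaledSum v ω)) ∂P| ≤ supDeriv g 0 := fun v => by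
      have := norm_integral_le_of_norm_le_const (μ := P)
        (f := fun ω => g (smoothMax β (rescaledSum v ω))) (ae_of_all _ fun ω => g0 _)
      simpa using this
    calc _ ≤ supDeriv g 0 + supDeriv g 0 := (abs_sub _ _).trans (add_le_add (hbd x) (hbd y))
      _ ≤ 4 * (supDeriv g 0 * γ) := by nlinarith
      _ ≤ _ := by
          unfold errorBound
          refine mul_le_mul (by linarith) (by linarith) hE4 (by linarith)
  · have x2 : ∀ i j, MemLp (fun ω => x i ω j) 2 P := fun i j =>
      (x3 i j).mono_exponent (by norm_num)
    have yj : ∀ i j, HasGaussianLaw (fun ω => y i ω j) P := fun i j =>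
      HasGaussianLaw.eval (X := fun j ω => y i ω j) (yG i) j
    have y3 : ∀ i j, MemLp (fun ω => y i ω j) 3 P := fun i j => (yj i j).memLp (by norm_num)
    have y2 : ∀ i j, MemLp (fun ω => y i ω j) 2 P := fun i j => (yj i j).memLp (by norm_num)
    have hsq : ∀ i j, ∫ ω, y i ω j ^ 2 ∂P = ∫ ω, x i ω j ^ 2 ∂P := fun i j => by
      simpa only [sq] using hcov i j j
    have hσ : ∀ j, sigma P y j = sigma P x j := fun j => by
      simp only [sigma, avgE, hsq]
    have hyx : ∀ i j, ∫ ω, |y i ω j| ^ 3 ∂P ≤ gaussThirdMoment * ∫ ω, |x i ω j| ^ 3 ∂P :=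
      fun i j => by
        rw [integral_abs_pow_three_of_hasGaussianLaw (yj i j) (y0 i j), hsq]
        exact mul_le_mul_of_nonneg_left (sqrt_integral_sq_pow_three_le (x3 i j)) hc
    set σ : Fin p → ℝ := sigma P x with hσdef
    set φ := phi P x y u with hφ
    set M := momentBound P x 2 with hM
    have σ0 : ∀ j, 0 ≤ σ j := sigma_nonneg x
    have σM : ∀ j, σ j ≤ M := sigma_le_momentBound x
    set t : Fin p → ℝ := fun j => u * σ j with ht
    have φx : ∀ j, ∑ i, tailMoment P (fun ω => x i ω j) (t j) ≤ φ ^ 2 * (n * σ j ^ 2) :=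
      sum_tailMoment_le hn hx x2 (le_max_left _ _)
    have φy : ∀ j, ∑ i, tailMoment P (fun ω => y i ω j) (t j) ≤ φ ^ 2 * (n * σ j ^ 2) := fun j => by
      have := sum_tailMoment_le hn hy y2 (le_max_right (truncImpact P x u) (truncImpact P y u)) j
      rwa [hσ] at this
    have px : 1 - γ ≤ P.real {ω | ∀ i j, |x i ω j| ≤ t j} :=
      one_sub_le_prob hn hx x2 hγ ((le_max_left _ _).trans huγ)
    have py : 1 - γ ≤ P.real {ω | ∀ i j, |y i ω j| ≤ t j} := by
      have := one_sub_le_prob hn hy y2 hγ ((le_max_right _ _).trans huγ)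
      simpa only [hσ] using this
    have φM : 0 ≤ φ * M := mul_nonneg nφ nM2
    have shift : ∀ v : Fin n → Ω → Fin p → ℝ, (∀ i, Measurable (v i)) → iIndepFun v P →
        (∀ i j, MemLp (fun ω => v i ω j) 2 P) → (∀ i j, ∫ ω, v i ω j ∂P = 0) →
        (∀ j, ∑ i, tailMoment P (fun ω => v i ω j) (t j) ≤ φ ^ 2 * (n * σ j ^ 2)) →
        1 - γ ≤ P.real {ω | ∀ i j, |v i ω j| ≤ t j} →
        |∫ ω, g (smoothMax β (rescaledSum v ω)) ∂P
          - ∫ ω, g (smoothMax β (rescaledSum (truncFamily P v t) ω)) ∂P|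
          ≤ 2 * supDeriv g 0 * γ + supDeriv g 1 * (φ * M) := fun v mv iv v2 v0 φv pv => by
      refine abs_integral_sub_truncCenter_le hn mv (fun j => ?_) pv
        (f := fun z => g (smoothMax β z))
        ((hg.1.continuous.comp (continuous_smoothMax β)).measurable) n1 (fun z => g0 _)
        (fun z z' d hd => ?_) φM
      · refine (abs_sum_integral_hardTrunc_le mv v2 v0 σ0 nφ φv
          (sum_prob_exceed_le_one mv iv (by linarith)) j).trans ?_
        gcongr
        exact σM j
      · exact (hg.abs_sub_le _ _).trans
          (mul_le_mul_of_nonneg_left (abs_smoothMax_sub_le hβ hd) n1)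
    have s₁ := shift x hx ix x2 x0 φx px
    have s₂ := shift y hy iy y2 y0 φy py
    have s₃ := abs_integral_truncFamily_sub_le hn (b := u * M) hβ (by
        rw [div_le_one hsn] at hub
        rw [show β * ((√(n : ℝ))⁻¹ * (2 * (u * M))) = (2 * (u * M) * β) / √n by
          rw [div_eq_mul_inv]; ring, div_le_one hsn]
        -- only `2 u M β ≤ √n` is needed, which has a factor `√2` to spare
        have h2 : 1 ≤ √2 := Real.one_le_sqrt.2 (by norm_num)
        have h3 : 0 ≤ 2 * (u * M) * β := by positivity
        nlinarith) hg hx hy ix iy x3 y3 x0 y0 hcov (t := t) (σ := σ)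
      (fun j => mul_nonneg hu.le (σ0 j)) (fun j => mul_le_mul_of_nonneg_left (σM j) hu.le) σ0 nφ σM
      (sum_integral_sq hn x) (fun j => by rw [sum_integral_sq hn y, hσ]) φx φy hc
      (L := momentBound P x 3 ^ 3) (fun j => by
        rw [← mul_avgE hn fun i ω => |x i ω j| ^ 3]
        exact mul_le_mul_of_nonneg_left (avgE_le_momentBound_pow x (by norm_num) j)
          (Nat.cast_nonneg n)) hyx
    have tri : ∀ a b a' b' : ℝ, |a - b| ≤ |a - a'| + |b - b'| + |a' - b'| := fun a b a' b' => by
      have h1 := abs_sub_le a a' b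
      have h2 := abs_sub_le a' b' b
      rw [abs_sub_comm b' b] at h2
      linarith
    refine (tri _ _ _ _).trans ((add_le_add (add_le_add s₁ s₂) s₃).trans ?_)
    unfold errorBound
    rw [← hφ, ← hM]
    set E₁ := (√(n : ℝ))⁻¹ * (supDeriv g 3 + supDeriv g 2 * β + supDeriv g 1 * β ^ 2)
      * momentBound P x 3 ^ 3 with hE₁
    set E₂ := (supDeriv g 2 + β * supDeriv g 1) * M ^ 2 * φ with hE₂
    set E₃ := supDeriv g 1 * M * φ with hE₃
    set E₄ := supDeriv g 0 * γ with hE₄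
    set r := √(Real.log (p / γ))
    set K := 1024 * Real.exp 12 * (1 + gaussThirdMoment) with hKdef
    have hK2 : 512 * Real.exp 12 ≤ K := by
      have := mul_nonneg (Real.exp_pos 12).le hc
      have := Real.exp_pos 12
      rw [hKdef]
      linarith
    calc _ = K * E₁ + 512 * Real.exp 12 * E₂ + 2 * E₃ + 4 * E₄ := by
          simp only [hE₁, hE₂, hE₃, hE₄, hKdef]
          ring
      _ ≤ K * E₁ + K * E₂ + 2 * (E₃ * r) + 4 * E₄ := by gcongr
      _ ≤ (K + 4) * (E₁ + E₂ + E₃ * r + E₄) := by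
          have h1 : 0 ≤ K * (E₃ * r) := mul_nonneg hK (hE3'.trans hE3)
          have h2 : 0 ≤ K * E₄ := mul_nonneg hK hE4
          linarith [hE3'.trans hE3]

end comparison

end GaussMax

theorem theorem2p1 :
    ∃ C : ℝ, 0 < C ∧
      ∀ (n p : ℕ), 1 ≤ n → 3 ≤ p →
      ∀ (Ω : Type*) [MeasurableSpace Ω] (P : Measure Ω) [IsProbabilityMeasure P]
        (x y : Fin n → Ω → Fin p → ℝ),
      -- the `x i` are independent centered random vectors with finite third absolute moments
      (∀ i, Measurable (x i)) → iIndepFun x P →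
      (∀ i j, MemLp (fun ω => x i ω j) 3 P) → (∀ i j, ∫ ω, x i ω j ∂P = 0) →
      -- the `y i` are independent, with `y i ~ N(0, E[xᵢ xᵢ'])`
      (∀ i, Measurable (y i)) → iIndepFun y P →
      (∀ i, HasGaussianLaw (y i) P) → (∀ i j, ∫ ω, y i ω j ∂P = 0) →
      (∀ i j k, ∫ ω, y i ω j * y i ω k ∂P = ∫ ω, x i ω j * x i ω k ∂P) →
      ∀ (β u γ : ℝ), 0 < β → 0 < u → 0 < γ → γ < 1 →
      2 * √2 * u * GaussMax.momentBound P x 2 * β / √(n : ℝ) ≤ 1 →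
      GaussMax.uGamma P x y γ ≤ u →
      ∀ g : ℝ → ℝ, GaussMax.IsCb3 g →
        |∫ ω, g (GaussMax.smoothMax β (GaussMax.rescaledSum x ω)) ∂P
            - ∫ ω, g (GaussMax.smoothMax β (GaussMax.rescaledSum y ω)) ∂P|
          ≤ C * GaussMax.errorBound P x y g β u γ ∧
        |∫ ω, g (GaussMax.maxCoord (GaussMax.rescaledSum x ω)) ∂P
            - ∫ ω, g (GaussMax.maxCoord (GaussMax.rescaledSum y ω)) ∂P|
          ≤ C * (GaussMax.errorBound P x y g β u γ
              + β⁻¹ * GaussMax.supDeriv g 1 * Real.log p) := by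
  have hc := GaussMax.gaussThirdMoment_nonneg
  refine ⟨1024 * Real.exp 12 * (1 + GaussMax.gaussThirdMoment) + 4, by positivity, ?_⟩
  intro n p hn hp Ω _ P _ x y hx ix x3 x0 hy iy yG y0 hcov β u γ hβ hu hγ hγ1 hub huγ g hg
  have : NeZero p := ⟨by omega⟩
  have hp3 : (3 : ℝ) ≤ p := by exact_mod_cast hp
  -- `p ≥ 3 > e`, so the logarithmic factor is at least one
  have hlog : 1 ≤ √(Real.log (p / γ)) := by
    rw [Real.one_le_sqrt, Real.le_log_iff_exp_le (by positivity)]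
    have h1 : (3 : ℝ) ≤ p / γ := by rw [le_div_iff₀ hγ]; nlinarith
    linarith [Real.exp_one_lt_d9]
  have main := GaussMax.abs_integral_smoothMax_rescaledSum_sub_le (by omega) hx ix x3 x0 hy iy yG
    y0 hcov hβ hu hγ hlog hub huγ hg
  refine ⟨main, ?_⟩
  have approx : ∀ v : Fin n → Ω → Fin p → ℝ, (∀ i, Measurable (v i)) →
      |∫ ω, g (GaussMax.maxCoord (GaussMax.rescaledSum v ω)) ∂P
        - ∫ ω, g (GaussMax.smoothMax β (GaussMax.rescaledSum v ω)) ∂P|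
        ≤ β⁻¹ * GaussMax.supDeriv g 1 * Real.log p := fun v hv => by
    have mr : Measurable (GaussMax.rescaledSum v) := measurable_pi_lambda _ fun j =>
      (Finset.measurable_fun_sum _ fun i _ => (measurable_pi_apply j).comp (hv i)).const_mul _
    have ib : ∀ f : (Fin p → ℝ) → ℝ, Measurable f →
        Integrable (fun ω => g (f (GaussMax.rescaledSum v ω))) P := fun f mf =>
      Integrable.of_bound ((hg.1.continuous.measurable.comp mf).comp mr).aestronglyMeasurable
        (GaussMax.supDeriv g 0) (ae_of_all _ fun ω => by
          have := hg.abs_le_supDeriv (k := 0) (by norm_num) (f (GaussMax.rescaledSum v ω))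
          rwa [iteratedDeriv_zero] at this)
    rw [← integral_sub (ib _ GaussMax.measurable_maxCoord)
      (ib _ (GaussMax.continuous_smoothMax β).measurable)]
    have := norm_integral_le_of_norm_le_const (μ := P)
      (C := β⁻¹ * GaussMax.supDeriv g 1 * Real.log p)
      (f := fun ω => g (GaussMax.maxCoord (GaussMax.rescaledSum v ω))
        - g (GaussMax.smoothMax β (GaussMax.rescaledSum v ω))) (ae_of_all _ fun ω => by
      refine (hg.abs_sub_le _ _).trans ?_
      have h1 := GaussMax.maxCoord_le_smoothMax hβ (GaussMax.rescaledSum v ω)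
      have h2 := GaussMax.smoothMax_le hβ (GaussMax.rescaledSum v ω)
      rw [abs_sub_comm, abs_of_nonneg (by linarith)]
      calc _ ≤ GaussMax.supDeriv g 1 * (β⁻¹ * Real.log p) :=
            mul_le_mul_of_nonneg_left (by linarith) (GaussMax.supDeriv_nonneg g 1)
        _ = _ := by ring)
    simpa using this
  have a₁ := approx x hx
  have a₂ := approx y hy
  have hR : 0 ≤ β⁻¹ * GaussMax.supDeriv g 1 * Real.log p := (abs_nonneg _).trans a₁
  have hKR : 0 ≤ 1024 * Real.exp 12 * (1 + GaussMax.gaussThirdMoment)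
      * (β⁻¹ * GaussMax.supDeriv g 1 * Real.log p) := by positivity
  rw [abs_le] at main a₁ a₂ ⊢
  constructor <;> linarith [main.1, main.2, a₁.1, a₁.2, a₂.1, a₂.2]
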